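/- Let $\alpha>2$, $0<p<\infty$, and let $\mathcal F^\phi_p$ be the space of entire functions $f$ with $$\|f\|_{\mathcal F^\phi_p}^p=\int_{\mathbb C}|f(z)|^p e^{-p|z|^\alpha}\,dm(z)<\infty ,$$ where $m$ is Lebesgue measure on $\mathbb C$ and $\phi(z)=|z|^\alpha$, with the topology of the (quasi-)norm $\|\cdot\|_{\mathcal F^\phi_p}$. Let $Vf(z)=\int_0^z f(\zeta)\,d\zeta$. Then $V$ maps $\mathcal F^\phi_p$ into itself; for every integer $N\ge 0$, $$\{f\in\mathcal F^\phi_p : f^{(k)}(0)=0 \text{ for } 0\le k\le N-1\}=\overline{\operatorname{span}\{z^k : k\ge N\}}^{\,\mathcal F^\phi_p};$$ and a linear subspace $\mathcal M$ of $\mathcal F^\phi_p$ is closed, satisfies $V\mathcal M\subseteq\mathcal M$, and is proper (that is, $\mathcal M\ne\{0\}$ and $\mathcal M\neq\mathcal F^\phi_p$) if and only if there is an integer $N\ge 1$ with $$\mathcal M=\{f\in\mathcal F^\phi_p : f^{(k)}(0)=0 \text{ for } 0\le k\le N-1\}.$$ -/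

import Mathlib

open scoped ENNReal
open MeasureTheory

noncomputable section

/-- The (quasi-)norm `‖f‖ = (∫_ℂ |f z| ^ p * exp (-p φ(|z|)) dm(z)) ^ (1/p)` (for `0 < p < ∞`),
with values in `[0, ∞]`; see `fockNorm_eq_lintegral`. -/
def fockNorm (φ : ℝ → ℝ) (p : ℝ≥0∞) (f : ℂ → ℂ) : ℝ≥0∞ :=
  eLpNorm (fun z : ℂ => (Real.exp (-φ ‖z‖) : ℂ) * f z) p volume

/-- The explicit formula for `fockNorm` when `0 < p < ∞`. -/
theorem fockNorm_eq_lintegral (φ : ℝ → ℝ) {p : ℝ≥0∞} (hp0 : p ≠ 0) (hp : p ≠ ∞) (f : ℂ → ℂ) :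
    fockNorm φ p f = (∫⁻ z : ℂ, ‖f z‖ₑ ^ p.toReal *
      ENNReal.ofReal (Real.exp (-p.toReal * φ ‖z‖))) ^ (1 / p.toReal) := by
  unfold fockNorm
  rw [eLpNorm_eq_lintegral_rpow_enorm_toReal hp0 hp]
  congr 1
  refine lintegral_congr fun z => ?_
  rw [enorm_mul, ENNReal.mul_rpow_of_nonneg _ _ ENNReal.toReal_nonneg, mul_comm]
  congr 1
  rw [← ofReal_norm, Complex.norm_real, Real.norm_eq_abs, Real.abs_exp,
    ENNReal.ofReal_rpow_of_pos (Real.exp_pos _), ← Real.exp_mul]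
  congr 2
  ring

/-- The entire functions `f` with `fockNorm φ p f < ∞`, as a space of functions on `ℂ`. -/
def fockSubmodule (φ : ℝ → ℝ) (p : ℝ≥0∞) : Submodule ℂ (ℂ → ℂ) where
  carrier := {f | Differentiable ℂ f ∧
    MemLp (fun z : ℂ => (Real.exp (-φ ‖z‖) : ℂ) * f z) p volume}
  zero_mem' := by
    refine ⟨differentiable_const 0, ?_⟩
    simp
  add_mem' := by
    rintro f g ⟨hf, hf'⟩ ⟨hg, hg'⟩
    refine ⟨hf.add hg, ?_⟩
    convert hf'.add hg' using 1
    funext z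
    simp [mul_add]
  smul_mem' := by
    rintro c f ⟨hf, hf'⟩
    refine ⟨hf.const_smul c, ?_⟩
    convert hf'.const_smul c using 1
    funext z
    simp [mul_left_comm]

/-- The weighted Fock space `F^φ_p`. A type of its own, so that it does not inherit the topology
of pointwise convergence from `ℂ → ℂ`. -/
def FockSpace (φ : ℝ → ℝ) (p : ℝ≥0∞) : Type := fockSubmodule φ p

namespace FockSpace

variable {φ : ℝ → ℝ} {p : ℝ≥0∞}

instance : AddCommGroup (FockSpace φ p) := inferInstanceAs (AddCommGroup (fockSubmodule φ p))

instance : Module ℂ (FockSpace φ p) := inferInstanceAs (Module ℂ (fockSubmodule φ p))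

/-- The underlying entire function. -/
def toFun (f : FockSpace φ p) : ℂ → ℂ := Subtype.val f

/-- The topology of the (quasi-)norm: `U` is open if around each of its points it contains a
ball of positive radius. -/
instance : TopologicalSpace (FockSpace φ p) where
  IsOpen U := ∀ f ∈ U, ∃ ε : ℝ≥0∞, 0 < ε ∧
    ∀ g : FockSpace φ p, fockNorm φ p (g - f).toFun < ε → g ∈ U
  isOpen_univ := fun _ _ => ⟨1, one_pos, fun _ _ => trivial⟩
  isOpen_inter := by
    rintro s t hs ht f ⟨hfs, hft⟩
    obtain ⟨a, ha, hsa⟩ := hs f hfs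
    obtain ⟨b, hb, htb⟩ := ht f hft
    exact ⟨min a b, lt_min ha hb, fun g hg =>
      ⟨hsa g (hg.trans_le (min_le_left _ _)), htb g (hg.trans_le (min_le_right _ _))⟩⟩
  isOpen_sUnion := by
    rintro S hS f ⟨s, hs, hfs⟩
    obtain ⟨a, ha, hsa⟩ := hS s hs f hfs
    exact ⟨a, ha, fun g hg => ⟨s, hs, hsa g hg⟩⟩

end FockSpace

/-- The Volterra operator `V f z = ∫_0^z f(ζ) dζ`, the integral being taken along the segment
`ζ = t z`, `0 ≤ t ≤ 1` (for entire `f` it does not depend on the path). -/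
def volterra (f : ℂ → ℂ) (z : ℂ) : ℂ := ∫ t in (0 : ℝ)..1, f ((t : ℂ) * z) * z

/-- `V M ⊆ M`. -/
def IsVolterraInvariant {φ : ℝ → ℝ} {p : ℝ≥0∞} (M : Submodule ℂ (FockSpace φ p)) : Prop :=
  ∀ f ∈ M, ∃ g ∈ M, g.toFun = volterra f.toFun

/-- The functions `f` in `F^φ_p` with `f^{(k)}(0) = 0` for all `k < N`. -/
def vanishingAtZero (φ : ℝ → ℝ) (p : ℝ≥0∞) (N : ℕ) : Set (FockSpace φ p) :=
  {f | ∀ k < N, iteratedDeriv k f.toFun 0 = 0}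

/-- The monomials `z ^ k`, `k ≥ N`, as elements of `F^φ_p`. -/
def monomialsFrom (φ : ℝ → ℝ) (p : ℝ≥0∞) (N : ℕ) : Set (FockSpace φ p) :=
  {f | ∃ k : ℕ, N ≤ k ∧ f.toFun = fun z : ℂ => z ^ k}

end

/-!
# Closed invariant subspaces of the Volterra operator on `F^φ_p`, `φ r = r ^ α`

Write `f_k = f^{(k)}(0)` and attach to `f` the power series `∑ f_k X^k` (`FockSpace.taylor`). The
Volterra operator `V` becomes multiplication by `X`, so an invariant subspace is stable under
multiplication by polynomials, and the problem is to control norms by coefficients. Put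
`ρ_k = k!^β α^(k/α)` with `β = 1 - 1/α > 0` (`coeffWeight`). Up to powers of `k`, the number `ρ_k`
bounds `|f_k|` for `f` in the space (`exists_norm_iteratedDeriv_le_fockMass`, from a sub-mean value
property of `|f|^P` and Cauchy's estimate), and the norm of `h` is at most
`∑ |h_k| (k + 1)^Q / ρ_k` (`exists_fockMass_le_tsum`). Both hold for all `0 < p < ∞`; no duality and
no triangle inequality is used. The losses, powers of `k`, are harmless because a shift by `L` gains
`ρ_k / ρ_(k+L) ≲ k^(-βL)`, as much as one likes.

*Invariant subspaces.* Let `M` be closed, invariant and nonzero, and let `f ∈ M` have the smallest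
order `N` at `0` that occurs in `M`, so that its series is `X^N b` with `b(0) ≠ 0`. Since
`ρ_j ρ_(n-j) / ρ_n = C(n,j)^(-β)` is small unless `j` is close to `0` or `n`, the inverse series
`b⁻¹` grows no faster than `b` does (`exists_norm_coeff_inv_le`), and the convolution of the two
satisfies the same bound. Hence, with `P_n` the truncation of `b⁻¹` after degree `n`, the series
`P_n X^K X^N b - X^(N+K)` starts after degree `n + N + K` and, for fixed large `K`, has small norm:
a multiple of `z^(N+K)` lies in `M` (`FockSpace.exists_X_pow_mem`). Then `M` contains everything
that vanishes to order `N + K`, and subtracting multiples of `V^j f` brings the order down to `N`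
(`FockSpace.vanishingAtZero_subset_of_mem`).

*Density of polynomials.* The Taylor sums of a dilation `f(r z)`, `r < 1`, converge by the geometric
decay `r^k`, and `f(r z) → f(z)` in norm as `r → 1` (`exists_fockMass_dilation_sub_le`).

*The Volterra operator acts on the space.* Here no loss is allowed, and `p` may be less than `1`.
The function `h = V f` is split as `h(z/2)` plus its increments between `(1 - δ) z` and
`(1 - δ/2) z`, for dyadic `δ`. An increment is at most `δ |z|` times the supremum of `|f|` on a
segment, which is controlled by the mean of `|f|^P` over a disc of radius comparable to `δ |z|`.
After exchanging the integrals, the decay of the weight between that disc and `z` turns this into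
the factor `δ^(Pβ)`, which is summable (`exists_fockMass_increment_le`, `fockMass_volterra_ne_top`).
-/

/-! ### Weighted sequences and inversion of power series -/

/-- The growth `k!^β * D ^ k`. -/
noncomputable def facWeight (β D : ℝ) (k : ℕ) : ℝ := (k.factorial : ℝ) ^ β * D ^ k

/-- The growth `k!^β * D ^ k` with a polynomial loss `(k + 1) ^ A`. -/
noncomputable def polyWeight (β D : ℝ) (A k : ℕ) : ℝ := ((k : ℝ) + 1) ^ A * facWeight β D k

section Weights

variable {β D : ℝ}

theorem facWeight_zero : facWeight β D 0 = 1 := by simp [facWeight]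

theorem polyWeight_zero (A : ℕ) : polyWeight β D A 0 = 1 := by simp [polyWeight, facWeight_zero]

theorem facWeight_pos (hD : 1 ≤ D) (k : ℕ) : 0 < facWeight β D k := by
  unfold facWeight; positivity

theorem one_le_facWeight (hβ : 0 < β) (hD : 1 ≤ D) (k : ℕ) : 1 ≤ facWeight β D k := by
  unfold facWeight
  exact one_le_mul_of_one_le_of_one_le
    (Real.one_le_rpow (by exact_mod_cast k.factorial_pos) hβ.le) (one_le_pow₀ hD)

theorem polyWeight_pos (hD : 1 ≤ D) (A k : ℕ) : 0 < polyWeight β D A k :=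
  mul_pos (by positivity) (facWeight_pos hD k)

theorem one_le_polyWeight (hβ : 0 < β) (hD : 1 ≤ D) (A k : ℕ) : 1 ≤ polyWeight β D A k :=
  one_le_mul_of_one_le_of_one_le (one_le_pow₀ (by simp)) (one_le_facWeight hβ hD k)

theorem facWeight_mul (j k : ℕ) :
    facWeight β D j * facWeight β D k * ((j + k).choose j : ℝ) ^ β = facWeight β D (j + k) := by
  have h : ((j + k).factorial : ℝ) = (j + k).choose j * j.factorial * k.factorial := by
    have := Nat.choose_mul_factorial_mul_factorial (Nat.le_add_right j k)
    rw [Nat.add_sub_cancel_left] at this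
    exact_mod_cast this.symm
  unfold facWeight
  rw [h, Real.mul_rpow (by positivity) (by positivity),
    Real.mul_rpow (by positivity) (by positivity), pow_add]
  ring

theorem mul_two_pow_le_mul_choose {j k : ℕ} (hj : 1 ≤ j) (hjk : j ≤ k) :
    (j + k) * 2 ^ j ≤ 2 * j * (j + k).choose j := by
  obtain ⟨i, rfl⟩ : ∃ i, j = i + 1 := ⟨j - 1, by omega⟩
  have h1 : (i + 1 + k) * (i + k).choose i = (i + 1 + k).choose (i + 1) * (i + 1) := by
    have := Nat.add_one_mul_choose_eq (i + k) i
    rw [show i + 1 + k = i + k + 1 by ring]; exact this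
  have h2 : 2 ^ i ≤ (i + k).choose i := by
    have h3 : ∀ i : ℕ, 2 ^ i ≤ (2 * i).choose i := by
      intro i
      induction i with
      | zero => simp
      | succ n ih =>
        have h4 := Nat.succ_mul_centralBinom_succ n
        simp only [Nat.centralBinom_eq_two_mul_choose] at h4
        have h5 : (n + 1) * (2 * (2 * n).choose n) ≤ (n + 1) * (2 * (n + 1)).choose (n + 1) := by
          rw [h4]
          nlinarith [Nat.zero_le ((2 * n).choose n), Nat.zero_le (n * (2 * n).choose n)]
        have h6 := Nat.le_of_mul_le_mul_left h5 (Nat.succ_pos n)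
        rw [pow_succ]; omega
    exact (h3 i).trans (Nat.choose_le_choose i (by omega))
  calc (i + 1 + k) * 2 ^ (i + 1) = 2 * ((i + 1 + k) * 2 ^ i) := by ring
    _ ≤ 2 * ((i + 1 + k) * (i + k).choose i) := by gcongr
    _ = _ := by rw [h1]; ring

/-- The summable majorant for half of the convolution of `polyWeight` with itself. -/
theorem polyWeight_mul_le (hβ : 0 < β) (hβ1 : β ≤ 1) (hD : 1 ≤ D) (A : ℕ) {j k : ℕ}
    (hj : 1 ≤ j) (hjk : j ≤ k) :
    polyWeight β D A j * polyWeight β D A k ≤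
      (2 * ((j : ℝ) + 1) ^ (A + 1) * ((2 : ℝ) ^ (-β)) ^ j) *
        (((j + k : ℕ) : ℝ) ^ (-β) * polyWeight β D A (j + k)) := by
  set c : ℝ := ((j + k).choose j : ℝ) with hc
  have hcpos : 0 < c := by
    rw [hc]; exact_mod_cast Nat.choose_pos (Nat.le_add_right j k)
  have hjpos : (0 : ℝ) < j := by exact_mod_cast hj
  have hn : (0 : ℝ) < ((j + k : ℕ) : ℝ) := by exact_mod_cast (by omega : 0 < j + k)
  have h1 : ((j + k : ℕ) : ℝ) * 2 ^ j ≤ 2 * j * c := by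
    rw [hc]; exact_mod_cast mul_two_pow_le_mul_choose hj hjk
  have h2 : ((j + k : ℕ) : ℝ) ^ β * ((2 : ℝ) ^ j) ^ β ≤ (2 * ((j : ℝ) + 1)) * c ^ β := by
    rw [← Real.mul_rpow hn.le (by positivity)]
    calc _ ≤ (2 * j * c) ^ β := Real.rpow_le_rpow (by positivity) h1 hβ.le
      _ = (2 * (j : ℝ)) ^ β * c ^ β := Real.mul_rpow (by positivity) hcpos.le
      _ ≤ (2 * ((j : ℝ) + 1)) * c ^ β := by
        gcongr
        calc (2 * (j : ℝ)) ^ β ≤ (2 * ((j : ℝ) + 1)) ^ β := by gcongr; simp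
          _ ≤ (2 * ((j : ℝ) + 1)) ^ (1 : ℝ) :=
            Real.rpow_le_rpow_of_exponent_le (by linarith) hβ1
          _ = _ := Real.rpow_one _
  have h3 : (c ^ β)⁻¹ ≤ (2 * ((j : ℝ) + 1)) * ((2 : ℝ) ^ (-β)) ^ j * ((j + k : ℕ) : ℝ) ^ (-β) := by
    have e1 : ((2 : ℝ) ^ (-β)) ^ j = (((2 : ℝ) ^ j) ^ β)⁻¹ := by
      rw [← Real.rpow_natCast, ← Real.rpow_natCast, ← Real.rpow_mul (by norm_num),
        ← Real.rpow_mul (by norm_num), ← Real.rpow_neg (by norm_num)]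
      congr 1; ring
    rw [e1, Real.rpow_neg hn.le]
    have : 0 < c ^ β := by positivity
    have : 0 < ((j + k : ℕ) : ℝ) ^ β := by positivity
    have : 0 < ((2 : ℝ) ^ j) ^ β := by positivity
    rw [inv_le_iff_one_le_mul₀ (by positivity)]
    field_simp
    nlinarith
  have h4 : facWeight β D j * facWeight β D k = (c ^ β)⁻¹ * facWeight β D (j + k) := by
    rw [← facWeight_mul (β := β) (D := D) j k, ← hc]
    field_simp
  unfold polyWeight
  have hw := facWeight_pos (β := β) hD (j + k)
  calc ((j : ℝ) + 1) ^ A * facWeight β D j * (((k : ℝ) + 1) ^ A * facWeight β D k)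
      = ((j : ℝ) + 1) ^ A * ((k : ℝ) + 1) ^ A * (facWeight β D j * facWeight β D k) := by ring
    _ ≤ ((j : ℝ) + 1) ^ A * (((j + k : ℕ) : ℝ) + 1) ^ A *
        ((2 * ((j : ℝ) + 1)) * ((2 : ℝ) ^ (-β)) ^ j * ((j + k : ℕ) : ℝ) ^ (-β) *
          facWeight β D (j + k)) := by
        rw [h4]
        gcongr
        simp
    _ = _ := by ring

/-- The inner part of the convolution of `polyWeight` with itself is of smaller order. -/
theorem exists_sum_Ico_polyWeight_le (hβ : 0 < β) (hβ1 : β ≤ 1) (hD : 1 ≤ D) (A : ℕ) :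
    ∃ S : ℝ, 0 ≤ S ∧ ∀ n : ℕ, ∑ j ∈ Finset.Ico 1 n, polyWeight β D A j * polyWeight β D A (n - j) ≤
      S * ((n : ℝ) ^ (-β) * polyWeight β D A n) := by
  set u : ℕ → ℝ := fun j => 2 * ((j : ℝ) + 1) ^ (A + 1) * ((2 : ℝ) ^ (-β)) ^ j with hu
  have hq : (2 : ℝ) ^ (-β) < 1 := Real.rpow_lt_one_of_one_lt_of_neg (by norm_num) (by linarith)
  have hq0 : 0 < (2 : ℝ) ^ (-β) := by positivity
  have hu0 : ∀ j, 0 ≤ u j := fun j => by positivity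
  have hus : Summable u := by
    have h := summable_pow_mul_geometric_of_norm_lt_one (R := ℝ) (A + 1) (r := (2 : ℝ) ^ (-β))
      (by rwa [Real.norm_of_nonneg hq0.le])
    have h' := ((summable_nat_add_iff 1).2 h).mul_left (2 * ((2 : ℝ) ^ (-β))⁻¹)
    refine h'.congr fun j => ?_
    simp only [hu]
    push_cast
    rw [pow_succ ((2 : ℝ) ^ (-β)) j]
    field_simp
  refine ⟨2 * ∑' j, u j, mul_nonneg zero_le_two (tsum_nonneg hu0), fun n => ?_⟩
  have hw := polyWeight_pos (β := β) hD A n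
  have key : ∀ j ∈ Finset.Ico 1 n, polyWeight β D A j * polyWeight β D A (n - j) ≤
      (u j + u (n - j)) * ((n : ℝ) ^ (-β) * polyWeight β D A n) := by
    intro j hj
    rw [Finset.mem_Ico] at hj
    have hnn : 0 ≤ (n : ℝ) ^ (-β) * polyWeight β D A n := by positivity
    rcases le_total j (n - j) with h | h
    · have := polyWeight_mul_le hβ hβ1 hD A hj.1 h
      rw [show j + (n - j) = n by omega] at this
      exact this.trans (mul_le_mul_of_nonneg_right (le_add_of_nonneg_right (hu0 _)) hnn)
    · have := polyWeight_mul_le hβ hβ1 hD A (by omega : 1 ≤ n - j) h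
      rw [show n - j + j = n by omega] at this
      rw [mul_comm (polyWeight β D A j)]
      exact this.trans (mul_le_mul_of_nonneg_right (le_add_of_nonneg_left (hu0 _)) hnn)
  refine (Finset.sum_le_sum key).trans ?_
  rw [← Finset.sum_mul]
  refine mul_le_mul_of_nonneg_right ?_ (by positivity)
  rw [Finset.sum_add_distrib, two_mul]
  have hsub : Finset.Ico 1 n ⊆ Finset.range (n + 1) := fun j hj => by
    simp only [Finset.mem_Ico, Finset.mem_range] at *; omega
  refine add_le_add (hus.sum_le_tsum _ fun _ _ => hu0 _) ?_
  calc ∑ j ∈ Finset.Ico 1 n, u (n - j) ≤ ∑ j ∈ Finset.range (n + 1), u (n - j) :=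
        Finset.sum_le_sum_of_subset_of_nonneg hsub fun _ _ _ => hu0 _
    _ = ∑ j ∈ Finset.range (n + 1), u j := by
        rw [← Finset.sum_range_reflect u (n + 1)]
        simp
    _ ≤ _ := hus.sum_le_tsum _ fun _ _ => hu0 _

theorem exists_sum_range_polyWeight_le (hβ : 0 < β) (hβ1 : β ≤ 1) (hD : 1 ≤ D) (A : ℕ) :
    ∃ S : ℝ, 0 ≤ S ∧ ∀ n : ℕ, ∑ j ∈ Finset.range (n + 1),
      polyWeight β D A j * polyWeight β D A (n - j) ≤ S * polyWeight β D A n := by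
  obtain ⟨S, hS, h⟩ := exists_sum_Ico_polyWeight_le hβ hβ1 hD A
  refine ⟨S + 2, by linarith, fun n => ?_⟩
  have hw := polyWeight_pos (β := β) hD A n
  rcases Nat.eq_zero_or_pos n with rfl | hn
  · simp only [zero_add, Finset.range_one, Finset.sum_singleton, Nat.sub_zero, polyWeight_zero]
    linarith
  · rw [Finset.sum_range_succ, Finset.range_eq_Ico, Finset.sum_eq_sum_Ico_succ_bot hn]
    simp only [polyWeight_zero, Nat.sub_zero, Nat.sub_self, one_mul, mul_one, zero_add]
    have h1 : (n : ℝ) ^ (-β) ≤ 1 :=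
      Real.rpow_le_one_of_one_le_of_nonpos (by exact_mod_cast hn) (by linarith)
    have h2 : S * ((n : ℝ) ^ (-β) * polyWeight β D A n) ≤ S * polyWeight β D A n := by
      gcongr
      exact mul_le_of_le_one_left hw.le h1
    linarith [h n]

/-- Power series whose coefficients are `O(polyWeight)` are closed under inversion: in the
recursion for the inverse all terms but the two extreme ones are of smaller order. -/
theorem exists_norm_coeff_inv_le (hβ : 0 < β) (hβ1 : β ≤ 1) (hD : 1 ≤ D) (A : ℕ)
    (b : PowerSeries ℂ) (hb0 : PowerSeries.constantCoeff b ≠ 0) {C : ℝ}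
    (hb : ∀ k, ‖PowerSeries.coeff k b‖ ≤ C * polyWeight β D A k) :
    ∃ C' : ℝ, 0 ≤ C' ∧ ∀ k, ‖PowerSeries.coeff k b⁻¹‖ ≤ C' * polyWeight β D A k := by
  obtain ⟨S, hS, hSn⟩ := exists_sum_Ico_polyWeight_le hβ hβ1 hD A
  set c : ℕ → ℂ := fun k => PowerSeries.coeff k b⁻¹ with hc
  set a : ℕ → ℂ := fun k => PowerSeries.coeff k b with ha
  have ha0 : 0 < ‖a 0‖ := by
    rw [norm_pos_iff, ha]; simpa using hb0
  have hC : 0 ≤ C := by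
    have := hb 0
    rw [polyWeight_zero, mul_one] at this
    exact (norm_nonneg _).trans this
  -- the recursion, with the two extreme terms separated
  have hrec : ∀ n, 1 ≤ n → ‖a 0‖ * ‖c n‖ ≤
      ‖a n‖ * ‖c 0‖ + ∑ j ∈ Finset.Ico 1 n, ‖a j‖ * ‖c (n - j)‖ := by
    intro n hn
    have h := congrArg (PowerSeries.coeff n) (PowerSeries.mul_inv_cancel b hb0)
    rw [PowerSeries.coeff_mul, PowerSeries.coeff_one, if_neg (by omega),
      Finset.Nat.sum_antidiagonal_eq_sum_range_succ_mk, Finset.sum_range_succ,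
      Finset.range_eq_Ico, Finset.sum_eq_sum_Ico_succ_bot (by omega)] at h
    simp only [Nat.sub_zero, Nat.sub_self, zero_add] at h
    have h' : a 0 * c n = -(a n * c 0 + ∑ j ∈ Finset.Ico 1 n, a j * c (n - j)) := by
      rw [eq_neg_iff_add_eq_zero, ← h]; simp only [ha, hc]; ring
    rw [← norm_mul, h', norm_neg]
    refine (norm_add_le _ _).trans (add_le_add (norm_mul _ _).le ?_)
    exact (norm_sum_le _ _).trans (Finset.sum_le_sum fun j _ => (norm_mul _ _).le)
  have hlim : Filter.Tendsto (fun n : ℕ => C * S * (n : ℝ) ^ (-β)) Filter.atTop (nhds 0) := by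
    have := ((tendsto_rpow_neg_atTop hβ).comp tendsto_natCast_atTop_atTop).const_mul (C * S)
    simpa using this
  -- from `n₀` on, the inner terms use up at most half of the bound
  obtain ⟨n₀, hn₀⟩ := Filter.eventually_atTop.1
    (hlim.eventually_le_const (half_pos ha0))
  set C' : ℝ := (∑ i ∈ Finset.range (n₀ + 1), ‖c i‖) + 2 * C * ‖c 0‖ / ‖a 0‖ with hC'
  have hsum0 : 0 ≤ ∑ i ∈ Finset.range (n₀ + 1), ‖c i‖ :=
    Finset.sum_nonneg fun _ _ => norm_nonneg _
  have hC'0 : 0 ≤ C' := by positivity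
  refine ⟨C', hC'0, fun k => ?_⟩
  induction k using Nat.strong_induction_on with
  | _ n ih =>
    have hw1 := one_le_polyWeight hβ hD A n
    have hw := polyWeight_pos (β := β) hD A n
    rcases Nat.lt_or_ge n (n₀ + 1) with hn | hn
    · have h1 : ‖c n‖ ≤ ∑ i ∈ Finset.range (n₀ + 1), ‖c i‖ :=
        Finset.single_le_sum (f := fun i => ‖c i‖) (fun _ _ => norm_nonneg _)
          (Finset.mem_range.2 hn)
      have h2 : 0 ≤ 2 * C * ‖c 0‖ / ‖a 0‖ := by positivity
      calc ‖c n‖ ≤ C' * 1 := by rw [hC']; linarith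
        _ ≤ _ := by gcongr
    · have h1 : ∑ j ∈ Finset.Ico 1 n, ‖a j‖ * ‖c (n - j)‖ ≤
          C * C' * (S * ((n : ℝ) ^ (-β) * polyWeight β D A n)) := by
        calc _ ≤ ∑ j ∈ Finset.Ico 1 n,
              C * C' * (polyWeight β D A j * polyWeight β D A (n - j)) := by
              refine Finset.sum_le_sum fun j hj => ?_
              rw [Finset.mem_Ico] at hj
              have := polyWeight_pos (β := β) hD A j
              calc ‖a j‖ * ‖c (n - j)‖ ≤ (C * polyWeight β D A j) *
                    (C' * polyWeight β D A (n - j)) := by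
                    gcongr
                    · exact hb j
                    · exact ih (n - j) (by omega)
                _ = _ := by ring
          _ ≤ _ := by
              rw [← Finset.mul_sum]
              gcongr
              exact hSn n
      have h2 : C * C' * (S * ((n : ℝ) ^ (-β) * polyWeight β D A n)) ≤
          C' * (‖a 0‖ / 2) * polyWeight β D A n := by
        have := hn₀ n (by omega)
        calc _ = C' * (C * S * (n : ℝ) ^ (-β)) * polyWeight β D A n := by ring
          _ ≤ _ := by gcongr
      have h3 : ‖a n‖ * ‖c 0‖ ≤ C' * (‖a 0‖ / 2) * polyWeight β D A n := by
        have : C * ‖c 0‖ ≤ C' * (‖a 0‖ / 2) := by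
          have e : 2 * C * ‖c 0‖ / ‖a 0‖ * (‖a 0‖ / 2) = C * ‖c 0‖ := by field_simp
          rw [hC', add_mul, e]
          linarith [mul_nonneg hsum0 (half_pos ha0).le]
        calc _ ≤ C * polyWeight β D A n * ‖c 0‖ := by gcongr; exact hb n
          _ = C * ‖c 0‖ * polyWeight β D A n := by ring
          _ ≤ _ := by gcongr
      have h4 : ‖a 0‖ * ‖c n‖ ≤ ‖a 0‖ * (C' * polyWeight β D A n) := by
        refine (hrec n (by omega)).trans ((add_le_add h3 (h1.trans h2)).trans_eq ?_)
        ring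
      exact le_of_mul_le_mul_left h4 ha0

/-- Truncating the inverse of `b` after degree `n` inverts `b` up to degree `n`, and the
coefficients of the error of degree `> n` are `O(polyWeight)`, uniformly in `n`. -/
theorem exists_norm_coeff_trunc_inv_mul_sub_one_le (hβ : 0 < β) (hβ1 : β ≤ 1) (hD : 1 ≤ D) (A : ℕ)
    (b : PowerSeries ℂ) (hb0 : PowerSeries.constantCoeff b ≠ 0) {C : ℝ}
    (hb : ∀ k, ‖PowerSeries.coeff k b‖ ≤ C * polyWeight β D A k) :
    ∃ C' : ℝ, 0 ≤ C' ∧ ∀ n m : ℕ,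
      ‖PowerSeries.coeff m ((PowerSeries.trunc (n + 1) b⁻¹ : PowerSeries ℂ) * b - 1)‖ ≤
        if m ≤ n then 0 else C' * polyWeight β D A m := by
  obtain ⟨C₁, hC₁, hinv⟩ := exists_norm_coeff_inv_le hβ hβ1 hD A b hb0 hb
  obtain ⟨S, hS, hconv⟩ := exists_sum_range_polyWeight_le hβ hβ1 hD A
  have hC : 0 ≤ C := by
    have := hb 0
    rw [polyWeight_zero, mul_one] at this
    exact (norm_nonneg _).trans this
  refine ⟨C₁ * C * S, by positivity, fun n m => ?_⟩
  rw [map_sub, PowerSeries.coeff_mul, Finset.Nat.sum_antidiagonal_eq_sum_range_succ_mk]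
  split_ifs with hm
  · have h := congrArg (PowerSeries.coeff m) (PowerSeries.inv_mul_cancel b hb0)
    rw [PowerSeries.coeff_mul, Finset.Nat.sum_antidiagonal_eq_sum_range_succ_mk] at h
    rw [← h, Finset.sum_congr rfl (g := fun j => PowerSeries.coeff j b⁻¹ *
      PowerSeries.coeff (m - j) b), sub_self, norm_zero]
    intro j hj
    rw [Finset.mem_range] at hj
    rw [Polynomial.coeff_coe, PowerSeries.coeff_trunc, if_pos (by omega)]
  · rw [PowerSeries.coeff_one, if_neg (by omega), sub_zero]
    calc _ ≤ ∑ j ∈ Finset.range m.succ,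
          C₁ * C * (polyWeight β D A j * polyWeight β D A (m - j)) := by
          refine (norm_sum_le _ _).trans (Finset.sum_le_sum fun j _ => ?_)
          have := polyWeight_pos (β := β) hD A j
          have := polyWeight_pos (β := β) hD A (m - j)
          rw [norm_mul, Polynomial.coeff_coe, PowerSeries.coeff_trunc]
          calc _ ≤ (C₁ * polyWeight β D A j) * (C * polyWeight β D A (m - j)) := by
                gcongr
                · split_ifs
                  · exact hinv j
                  · rw [norm_zero]; positivity
                · exact hb _
            _ = _ := by ring
      _ ≤ _ := by
          rw [← Finset.mul_sum, mul_assoc (C₁ * C)]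
          gcongr
          exact hconv m

end Weights

/-! ### A sub-mean value property of `‖f‖ ^ P` for every `P > 0` -/

theorem two_pi_mul_enorm_le_lintegral {f : ℂ → ℂ} (hf : Differentiable ℂ f) (r : ℝ) :
    ENNReal.ofReal (2 * Real.pi) * ‖f 0‖ₑ ≤
      ∫⁻ θ in Set.Ioo (-Real.pi) Real.pi, ‖f (circleMap 0 r θ)‖ₑ := by
  have h1 : Real.circleAverage f 0 r = f 0 := hf.diffContOnCl.circleAverage
  rw [Real.circleAverage_eq_integral_add (-Real.pi),
    intervalIntegral.integral_comp_add_right (fun θ => f (circleMap 0 r θ))] at h1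
  have hpi := Real.pi_pos
  have e : ∫ θ in (0 + -Real.pi)..(2 * Real.pi + -Real.pi), f (circleMap 0 r θ) =
      ∫ θ in Set.Ioo (-Real.pi) Real.pi, f (circleMap 0 r θ) := by
    rw [intervalIntegral.integral_of_le (by linarith), integral_Ioc_eq_integral_Ioo]
    congr 3 <;> ring_nf
  rw [e] at h1
  have h2 : (2 * Real.pi) • f 0 = ∫ θ in Set.Ioo (-Real.pi) Real.pi, f (circleMap 0 r θ) := by
    rw [← h1, smul_smul, mul_inv_cancel₀ (by positivity), one_smul]
  calc _ = ‖(2 * Real.pi) • f 0‖ₑ := by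
        rw [enorm_smul, Real.enorm_eq_ofReal (by positivity)]
    _ ≤ _ := by rw [h2]; exact enorm_integral_le_lintegral_enorm _

theorem lintegral_ofReal_id_Ioo {ρ : ℝ} (hρ : 0 < ρ) :
    ∫⁻ r in Set.Ioo 0 ρ, ENNReal.ofReal r = ENNReal.ofReal (ρ ^ 2 / 2) := by
  rw [← ofReal_integral_eq_lintegral_ofReal, ← integral_Ioc_eq_integral_Ioo,
    ← intervalIntegral.integral_of_le hρ.le, integral_id]
  · simp
  · exact (continuous_id.integrableOn_Icc (a := 0) (b := ρ)).mono_set Set.Ioo_subset_Icc_self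
  · exact (ae_restrict_mem measurableSet_Ioo).mono fun r hr => hr.1.le

/-- The mean value inequality over a disc. -/
theorem enorm_mul_volume_ball_le {f : ℂ → ℂ} (hf : Differentiable ℂ f) (c : ℂ) {ρ : ℝ}
    (hρ : 0 < ρ) :
    ‖f c‖ₑ * ENNReal.ofReal (Real.pi * ρ ^ 2) ≤ ∫⁻ z in Metric.ball c ρ, ‖f z‖ₑ := by
  set g : ℂ → ℂ := fun z => f (z + c) with hg
  have hgd : Differentiable ℂ g := hf.comp (differentiable_id.add_const c)
  have e1 : ∫⁻ z in Metric.ball c ρ, ‖f z‖ₑ =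
      ∫⁻ z, (Metric.ball (0 : ℂ) ρ).indicator (fun z => ‖g z‖ₑ) z := by
    rw [← lintegral_indicator measurableSet_ball, ← lintegral_add_right_eq_self _ c]
    refine lintegral_congr fun z => ?_
    simp only [Set.indicator, Metric.mem_ball, dist_eq_norm, add_sub_cancel_right, sub_zero, hg]
  have hpi := Real.pi_pos
  rw [e1, ← Complex.lintegral_comp_polarCoord_symm]
  have e2 : ∀ q ∈ Set.Ioo 0 ρ ×ˢ Set.Ioo (-Real.pi) Real.pi,
      ENNReal.ofReal q.1 • (Metric.ball (0 : ℂ) ρ).indicator (fun z => ‖g z‖ₑ)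
        (Complex.polarCoord.symm q) = ENNReal.ofReal q.1 * ‖g (circleMap 0 q.1 q.2)‖ₑ := by
    rintro ⟨r, θ⟩ ⟨hr, hθ⟩
    have hr' : 0 < r ∧ r < ρ := hr
    have e3 : Complex.polarCoord.symm (r, θ) = circleMap 0 r θ := by
      rw [Complex.polarCoord_symm_apply, circleMap_zero, Complex.exp_mul_I]
      simp
    rw [e3, Set.indicator_of_mem, smul_eq_mul]
    rw [Metric.mem_ball, dist_zero_right, norm_circleMap_zero, abs_of_pos hr'.1]
    exact hr'.2
  calc ‖f c‖ₑ * ENNReal.ofReal (Real.pi * ρ ^ 2)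
      = ∫⁻ r in Set.Ioo 0 ρ, ENNReal.ofReal r * (ENNReal.ofReal (2 * Real.pi) * ‖g 0‖ₑ) := by
        rw [lintegral_mul_const _ (by fun_prop), lintegral_ofReal_id_Ioo hρ, ← mul_assoc,
          ← ENNReal.ofReal_mul (by positivity), mul_comm]
        simp only [hg, zero_add]
        congr 2; ring
    _ ≤ ∫⁻ r in Set.Ioo 0 ρ, ∫⁻ θ in Set.Ioo (-Real.pi) Real.pi,
          ENNReal.ofReal r * ‖g (circleMap 0 r θ)‖ₑ := by
        refine lintegral_mono fun r => ?_
        rw [lintegral_const_mul' _ _ ENNReal.ofReal_ne_top]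
        gcongr
        exact two_pi_mul_enorm_le_lintegral hgd r
    _ = ∫⁻ q in Set.Ioo 0 ρ ×ˢ Set.Ioo (-Real.pi) Real.pi,
          ENNReal.ofReal q.1 * ‖g (circleMap 0 q.1 q.2)‖ₑ := by
        have hc : Continuous fun q : ℝ × ℝ => ‖g (circleMap 0 q.1 q.2)‖ₑ := by
          have : Continuous fun q : ℝ × ℝ => circleMap 0 q.1 q.2 := by
            unfold circleMap; fun_prop
          exact (hgd.continuous.comp this).enorm
        have hm : Measurable fun q : ℝ × ℝ =>
            ENNReal.ofReal q.1 * ‖g (circleMap 0 q.1 q.2)‖ₑ :=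
          (ENNReal.measurable_ofReal.comp measurable_fst).mul hc.measurable
        rw [Measure.volume_eq_prod, setLIntegral_prod _ hm.aemeasurable]
    _ = ∫⁻ q in Set.Ioo 0 ρ ×ˢ Set.Ioo (-Real.pi) Real.pi,
          ENNReal.ofReal q.1 • (Metric.ball (0 : ℂ) ρ).indicator (fun z => ‖g z‖ₑ)
            (Complex.polarCoord.symm q) :=
        (setLIntegral_congr_fun (measurableSet_Ioo.prod measurableSet_Ioo) e2).symm
    _ ≤ _ := by
        refine lintegral_mono_set ?_
        rw [polarCoord_target]
        exact Set.prod_mono (fun r hr => hr.1) subset_rfl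

/-- For every `P > 0` (also `P < 1`, where Jensen's inequality is of no use) the value of
`‖f‖ ^ P` at a point is controlled by its integral over a disc. The proof maximises
`‖f z‖ ^ P * (ρ - ‖z - c‖) ^ 2`; around a maximum point `f` is bounded by a constant times its
value there, so that `‖f‖` and `‖f‖ ^ P` are comparable where `‖f‖` is not small. -/
theorem exists_enorm_rpow_le_lintegral_ball {P : ℝ} (hP : 0 < P) :
    ∃ C : ℝ, 0 < C ∧ ∀ f : ℂ → ℂ, Differentiable ℂ f → ∀ (c : ℂ) (ρ : ℝ), 0 < ρ →
      ‖f c‖ₑ ^ P ≤ ENNReal.ofReal (C / ρ ^ 2) * ∫⁻ z in Metric.ball c ρ, ‖f z‖ₑ ^ P := by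
  -- `f` is at most `B` times its value at the maximum point on a disc of half the distance to the
  -- boundary; `K` compares `‖f‖ ^ (1 - P)` with this value where `‖f‖` is at least half of it
  set B : ℝ := 4 ^ (1 / P) with hB
  have hB0 : 0 < B := by positivity
  set K : ℝ := max (B ^ (1 - P)) ((1 / 2) ^ (1 - P)) with hK
  have hK0 : 0 < K := lt_max_of_lt_left (by positivity)
  have hpi := Real.pi_pos
  refine ⟨8 * K / Real.pi, by positivity, fun f hf c ρ hρ => ?_⟩
  rcases eq_or_ne (∫⁻ z in Metric.ball c ρ, ‖f z‖ₑ ^ P) ∞ with hI | hI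
  · rw [hI, ENNReal.mul_top (by simpa using by positivity)]; exact le_top
  rcases eq_or_ne (f c) 0 with h0 | h0
  · rw [h0, enorm_zero, ENNReal.zero_rpow_of_pos hP]; exact zero_le
  set G : ℂ → ℝ := fun z => ‖f z‖ ^ P * (ρ - ‖z - c‖) ^ 2 with hG
  have hGc : Continuous G := by
    have := hf.continuous
    exact (this.norm.rpow_const fun _ => Or.inr hP.le).mul (by fun_prop)
  obtain ⟨z₀, hz₀, hmax⟩ := (isCompact_closedBall c ρ).exists_isMaxOn
    (Metric.nonempty_closedBall.2 hρ.le) hGc.continuousOn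
  have hGcpos : 0 < G c := by
    have : 0 < ‖f c‖ := norm_pos_iff.2 h0
    simp only [hG, sub_self, norm_zero, sub_zero]; positivity
  have hcmax : G c ≤ G z₀ := hmax (Metric.mem_closedBall_self hρ.le)
  have hG0 : 0 < G z₀ := hGcpos.trans_le hcmax
  rw [Metric.mem_closedBall, dist_eq_norm] at hz₀
  set d : ℝ := ρ - ‖z₀ - c‖ with hd
  set a : ℝ := ‖f z₀‖ with ha
  have hGz : G z₀ = a ^ P * d ^ 2 := rfl
  have hd0 : 0 < d := by
    refine lt_of_le_of_ne (by rw [hd]; linarith) fun h => ?_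
    rw [hGz, ← h] at hG0; simp at hG0
  have ha0 : 0 < a := by
    refine lt_of_le_of_ne (norm_nonneg _) fun h => ?_
    rw [hGz, ← h, Real.zero_rpow hP.ne'] at hG0; simp at hG0
  have hsub : Metric.ball z₀ (d / 2) ⊆ Metric.ball c ρ := by
    refine Metric.ball_subset_ball' ?_
    rw [dist_eq_norm]; linarith
  have hbound : ∀ z ∈ Metric.ball z₀ (d / 2), ‖f z‖ ≤ B * a := by
    intro z hz
    have hz' := hz
    rw [Metric.mem_ball, dist_eq_norm] at hz'
    have hzc : ‖z - c‖ ≤ ‖z - z₀‖ + ‖z₀ - c‖ := norm_sub_le_norm_sub_add_norm_sub _ _ _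
    have h1 : d / 2 ≤ ρ - ‖z - c‖ := by linarith
    have h2 : ‖f z‖ ^ P * (d / 2) ^ 2 ≤ a ^ P * d ^ 2 := by
      calc _ ≤ G z := by simp only [hG]; gcongr
        _ ≤ G z₀ := hmax (Metric.ball_subset_closedBall (hsub hz))
    have h3 : ‖f z‖ ^ P ≤ (B * a) ^ P := by
      rw [Real.mul_rpow hB0.le ha0.le, hB, ← Real.rpow_mul (by norm_num),
        one_div_mul_cancel hP.ne', Real.rpow_one]
      have : 0 < d ^ 2 := by positivity
      nlinarith
    exact (Real.rpow_le_rpow_iff (norm_nonneg _) (by positivity) hP).1 h3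
  have hsplit : ∀ z ∈ Metric.ball z₀ (d / 2), ‖f z‖ ≤ a / 2 + K * a ^ (1 - P) * ‖f z‖ ^ P := by
    intro z hz
    rcases le_total ‖f z‖ (a / 2) with h | h
    · have : 0 ≤ K * a ^ (1 - P) * ‖f z‖ ^ P := by positivity
      linarith
    · have hpos : 0 < ‖f z‖ := (half_pos ha0).trans_le h
      have h1 : ‖f z‖ ^ (1 - P) ≤ K * a ^ (1 - P) := by
        rcases le_total P 1 with hP1 | hP1
        · calc _ ≤ (B * a) ^ (1 - P) := Real.rpow_le_rpow hpos.le (hbound z hz) (by linarith)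
            _ = B ^ (1 - P) * a ^ (1 - P) := Real.mul_rpow hB0.le ha0.le
            _ ≤ _ := by gcongr; exact le_max_left _ _
        · calc _ ≤ (1 / 2 * a) ^ (1 - P) :=
                Real.rpow_le_rpow_of_nonpos (by positivity) (by linarith) (by linarith)
            _ = (1 / 2) ^ (1 - P) * a ^ (1 - P) := Real.mul_rpow (by norm_num) ha0.le
            _ ≤ _ := by gcongr; exact le_max_right _ _
      calc ‖f z‖ = ‖f z‖ ^ (1 - P) * ‖f z‖ ^ P := by
            rw [← Real.rpow_add hpos]; simp
        _ ≤ K * a ^ (1 - P) * ‖f z‖ ^ P := by gcongr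
        _ ≤ _ := by linarith
  set I : ℝ := (∫⁻ z in Metric.ball c ρ, ‖f z‖ₑ ^ P).toReal with hIdef
  have hI' : ∫⁻ z in Metric.ball c ρ, ‖f z‖ₑ ^ P = ENNReal.ofReal I :=
    (ENNReal.ofReal_toReal hI).symm
  have hI0 : 0 ≤ I := ENNReal.toReal_nonneg
  have hvol : volume (Metric.ball z₀ (d / 2)) = ENNReal.ofReal (Real.pi * (d / 2) ^ 2) := by
    rw [Complex.volume_ball, ← ENNReal.ofReal_pow (by positivity), mul_comm Real.pi,
      ENNReal.ofReal_mul (by positivity)]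
    congr 1
    rw [ENNReal.ofReal, Real.toNNReal_of_nonneg hpi.le]; rfl
  have hmv := enorm_mul_volume_ball_le hf z₀ (half_pos hd0)
  have hle : ∫⁻ z in Metric.ball z₀ (d / 2), ‖f z‖ₑ ≤
      ENNReal.ofReal (a / 2 * (Real.pi * (d / 2) ^ 2) + K * a ^ (1 - P) * I) := by
    calc _ ≤ ∫⁻ z in Metric.ball z₀ (d / 2),
          (ENNReal.ofReal (a / 2) + ENNReal.ofReal (K * a ^ (1 - P)) * ‖f z‖ₑ ^ P) := by
          refine setLIntegral_mono' measurableSet_ball fun z hz => ?_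
          rw [← ofReal_norm, ENNReal.ofReal_rpow_of_nonneg (norm_nonneg _) hP.le,
            ← ENNReal.ofReal_mul (by positivity), ← ENNReal.ofReal_add (by positivity)
              (by positivity)]
          exact ENNReal.ofReal_le_ofReal (hsplit z hz)
      _ = ENNReal.ofReal (a / 2) * ENNReal.ofReal (Real.pi * (d / 2) ^ 2) +
          ENNReal.ofReal (K * a ^ (1 - P)) * ∫⁻ z in Metric.ball z₀ (d / 2), ‖f z‖ₑ ^ P := by
          rw [lintegral_add_left measurable_const, lintegral_const_mul' _ _ ENNReal.ofReal_ne_top,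
            lintegral_const, Measure.restrict_apply_univ, hvol]
      _ ≤ ENNReal.ofReal (a / 2) * ENNReal.ofReal (Real.pi * (d / 2) ^ 2) +
          ENNReal.ofReal (K * a ^ (1 - P)) * ENNReal.ofReal I := by
          rw [← hI']
          gcongr
      _ = _ := by
          rw [← ENNReal.ofReal_mul (by positivity), ← ENNReal.ofReal_mul (by positivity),
            ← ENNReal.ofReal_add (by positivity) (by positivity)]
  have h1 := hmv.trans hle
  rw [← ofReal_norm, ← ENNReal.ofReal_mul (norm_nonneg _),
    ENNReal.ofReal_le_ofReal_iff (by positivity)] at h1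
  have h2 : a * (Real.pi * d ^ 2) ≤ 8 * (K * a ^ (1 - P) * I) := by
    have : a * (Real.pi * (d / 2) ^ 2) ≤
        a / 2 * (Real.pi * (d / 2) ^ 2) + K * a ^ (1 - P) * I := h1
    nlinarith
  have h3 : a ^ P * d ^ 2 ≤ 8 * K / Real.pi * I := by
    have e : a = a ^ (1 - P) * a ^ P := by rw [← Real.rpow_add ha0]; simp
    have hpos : 0 < a ^ (1 - P) := by positivity
    have h4 : a ^ (1 - P) * (a ^ P * d ^ 2 * Real.pi) ≤ a ^ (1 - P) * (8 * K * I) := by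
      calc _ = (a ^ (1 - P) * a ^ P) * (Real.pi * d ^ 2) := by ring
        _ = a * (Real.pi * d ^ 2) := by rw [← e]
        _ ≤ _ := h2
        _ = _ := by ring
    have h5 := le_of_mul_le_mul_left h4 hpos
    rw [div_mul_eq_mul_div, le_div_iff₀ hpi]
    exact h5
  have h4 : ‖f c‖ ^ P * ρ ^ 2 ≤ 8 * K / Real.pi * I := by
    have e : G c = ‖f c‖ ^ P * ρ ^ 2 := by simp [hG]
    rw [← e]; exact hcmax.trans h3
  rw [hI', ← ENNReal.ofReal_mul (by positivity), ← ofReal_norm,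
    ENNReal.ofReal_rpow_of_nonneg (norm_nonneg _) hP.le]
  refine ENNReal.ofReal_le_ofReal ?_
  rw [div_mul_eq_mul_div, le_div_iff₀ (by positivity)]
  exact h4

/-! ### Taylor coefficients and the norm -/

/-- The `P`-th power of the norm, `∫ ‖f z‖ ^ P * exp (-P ‖z‖ ^ α)`. -/
noncomputable def fockMass (α P : ℝ) (f : ℂ → ℂ) : ℝ≥0∞ :=
  ∫⁻ z : ℂ, ‖f z‖ₑ ^ P * ENNReal.ofReal (Real.exp (-P * ‖z‖ ^ α))

/-- The growth of the Taylor coefficients `f^{(k)}(0)` of functions in the Fock space, up to powers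
of `k`; its reciprocal is the size of `z ^ k / k!`, up to powers of `k`. -/
noncomputable def coeffWeight (α : ℝ) (k : ℕ) : ℝ := facWeight (1 - 1 / α) (α ^ (1 / α)) k

section Coefficients

variable {α P : ℝ}

theorem one_le_rpow_inv_self (hα : 1 < α) : 1 ≤ α ^ (1 / α) :=
  Real.one_le_rpow hα.le (by positivity)

theorem coeffWeight_pos (hα : 1 < α) (k : ℕ) : 0 < coeffWeight α k :=
  facWeight_pos (one_le_rpow_inv_self hα) k

theorem continuous_exp_neg_norm_rpow (hα : 1 < α) (P : ℝ) :
    Continuous fun z : ℂ => ENNReal.ofReal (Real.exp (-P * ‖z‖ ^ α)) := by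
  refine ENNReal.continuous_ofReal.comp (Real.continuous_exp.comp (continuous_const.mul ?_))
  exact continuous_norm.rpow_const fun _ => Or.inr (by linarith)

theorem add_rpow_le_rpow_add_of_small (hα : 1 < α) {x ρ : ℝ} (hx : 0 ≤ x) (hρ0 : 0 < ρ)
    (hρ1 : ρ ≤ 1) (hρ : ρ * (1 + x) ^ (α - 1) ≤ 1) : (x + ρ) ^ α ≤ x ^ α + α := by
  set u : ℝ := x + ρ with hu
  have hu0 : 0 < u := by positivity
  have h1 : 1 + α * (-(ρ / u)) ≤ (1 + -(ρ / u)) ^ α := by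
    refine one_add_mul_self_le_rpow_one_add ?_ hα.le
    have : ρ / u ≤ 1 := (div_le_one hu0).2 (by linarith)
    linarith
  have h2 : (1 + -(ρ / u)) ^ α * u ^ α = x ^ α := by
    rw [← Real.mul_rpow _ hu0.le]
    · congr 1
      field_simp
      rw [hu]; ring
    · have : ρ / u ≤ 1 := (div_le_one hu0).2 (by linarith)
      linarith
  have h3 : u ^ α = u ^ (α - 1) * u := by
    rw [← Real.rpow_add_one hu0.ne']; congr 1; ring
  have h4 : u ^ (α - 1) ≤ (1 + x) ^ (α - 1) :=
    Real.rpow_le_rpow hu0.le (by linarith) (by linarith)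
  have h5 : (1 + α * (-(ρ / u))) * u ^ α ≤ x ^ α := by
    rw [← h2]; gcongr
  have h6 : (1 + α * (-(ρ / u))) * u ^ α = u ^ α - α * (ρ * u ^ (α - 1)) := by
    rw [h3]; field_simp; ring
  have h7 : ρ * u ^ (α - 1) ≤ 1 := (mul_le_mul_of_nonneg_left h4 hρ0.le).trans hρ
  nlinarith

/-- Functions in the Fock space are bounded by the reciprocal of the weight, up to a power. -/
theorem exists_norm_le_fockMass (hα : 1 < α) (hP : 0 < P) :
    ∃ (A : ℕ) (C : ℝ), 0 < C ∧ ∀ f : ℂ → ℂ, Differentiable ℂ f → fockMass α P f ≠ ∞ →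
      ∀ z, ‖f z‖ ≤ C * (1 + ‖z‖) ^ A * Real.exp (‖z‖ ^ α) *
        ((fockMass α P f) ^ (1 / P)).toReal := by
  obtain ⟨C₀, hC₀, hmean⟩ := exists_enorm_rpow_le_lintegral_ball hP
  obtain ⟨n, hn⟩ := exists_nat_ge α
  obtain ⟨A, hA⟩ := exists_nat_ge (2 * n / P : ℝ)
  refine ⟨A, (C₀ * Real.exp (P * α)) ^ (1 / P), by positivity, fun f hf hI z => ?_⟩
  set I := fockMass α P f with hIdef
  -- on a disc of this radius `‖w‖ ^ α` varies by at most a constant, since `n ≥ α - 1`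
  set ρ : ℝ := ((1 + ‖z‖) ^ n)⁻¹ with hρdef
  have hz1 : 1 ≤ 1 + ‖z‖ := by simp
  have hρ0 : 0 < ρ := by positivity
  have hρ1 : ρ ≤ 1 := inv_le_one_of_one_le₀ (one_le_pow₀ hz1)
  have hρ2 : ρ * (1 + ‖z‖) ^ (α - 1) ≤ 1 := by
    have h : (1 + ‖z‖) ^ (α - 1) ≤ (1 + ‖z‖) ^ n := by
      rw [← Real.rpow_natCast]
      exact Real.rpow_le_rpow_of_exponent_le hz1 (by linarith)
    rw [hρdef, inv_mul_le_iff₀ (by positivity), mul_one]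
    exact h
  have hexp : ∀ w ∈ Metric.ball z ρ, 1 ≤ Real.exp (P * α) * Real.exp (P * ‖z‖ ^ α) *
      Real.exp (-P * ‖w‖ ^ α) := by
    intro w hw
    rw [Metric.mem_ball, dist_eq_norm] at hw
    rw [← Real.exp_add, ← Real.exp_add]
    refine Real.one_le_exp ?_
    have h1 : ‖w‖ ≤ ‖z‖ + ρ := by
      have := norm_sub_norm_le w z
      linarith
    have h2 : ‖w‖ ^ α ≤ ‖z‖ ^ α + α :=
      (Real.rpow_le_rpow (norm_nonneg _) h1 (by linarith)).trans
        (add_rpow_le_rpow_add_of_small hα (norm_nonneg z) hρ0 hρ1 hρ2)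
    nlinarith
  have h1 : ‖f z‖ₑ ^ P ≤ ENNReal.ofReal (C₀ / ρ ^ 2) *
      (ENNReal.ofReal (Real.exp (P * α) * Real.exp (P * ‖z‖ ^ α)) * I) := by
    refine (hmean f hf z ρ hρ0).trans ?_
    gcongr
    calc ∫⁻ w in Metric.ball z ρ, ‖f w‖ₑ ^ P
        ≤ ∫⁻ w in Metric.ball z ρ, ENNReal.ofReal (Real.exp (P * α) * Real.exp (P * ‖z‖ ^ α)) *
          (‖f w‖ₑ ^ P * ENNReal.ofReal (Real.exp (-P * ‖w‖ ^ α))) := by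
          refine setLIntegral_mono' measurableSet_ball fun w hw => ?_
          rw [mul_left_comm, ← ENNReal.ofReal_mul (by positivity)]
          refine le_mul_of_one_le_right zero_le ?_
          rw [ENNReal.one_le_ofReal]
          exact hexp w hw
      _ ≤ _ := by
          rw [lintegral_const_mul' _ _ ENNReal.ofReal_ne_top]
          gcongr
          exact setLIntegral_le_lintegral _ _
  have hIr : I = ENNReal.ofReal I.toReal := (ENNReal.ofReal_toReal hI).symm
  have hI0 : 0 ≤ I.toReal := ENNReal.toReal_nonneg
  rw [hIr, ← ENNReal.ofReal_mul (by positivity), ← ENNReal.ofReal_mul (by positivity),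
    ← ofReal_norm, ENNReal.ofReal_rpow_of_nonneg (norm_nonneg _) hP.le,
    ENNReal.ofReal_le_ofReal_iff (by positivity)] at h1
  rw [← ENNReal.toReal_rpow]
  have h2 : ‖f z‖ = (‖f z‖ ^ P) ^ (1 / P) := by
    rw [← Real.rpow_mul (norm_nonneg _), mul_one_div_cancel hP.ne', Real.rpow_one]
  rw [h2]
  calc (‖f z‖ ^ P) ^ (1 / P) ≤ (C₀ * Real.exp (P * α) * (1 + ‖z‖) ^ (2 * n) *
        Real.exp (P * ‖z‖ ^ α) * I.toReal) ^ (1 / P) := by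
        refine Real.rpow_le_rpow (by positivity) (h1.trans_eq ?_) (by positivity)
        rw [hρdef]
        field_simp
        ring
    _ = (C₀ * Real.exp (P * α)) ^ (1 / P) * ((1 + ‖z‖) ^ (2 * n)) ^ (1 / P) *
        Real.exp (‖z‖ ^ α) * I.toReal ^ (1 / P) := by
        rw [Real.mul_rpow (by positivity) hI0, Real.mul_rpow (by positivity) (by positivity),
          Real.mul_rpow (by positivity) (by positivity), ← Real.exp_mul]
        congr 3
        field_simp
    _ ≤ _ := by
        gcongr
        rw [← Real.rpow_natCast, ← Real.rpow_mul (by positivity), ← Real.rpow_natCast]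
        refine Real.rpow_le_rpow_of_exponent_le hz1 ?_
        calc _ = (2 * n / P : ℝ) := by push_cast; ring
          _ ≤ _ := hA

theorem factorial_mul_exp_le {k : ℕ} (hk : 1 ≤ k) :
    (k.factorial : ℝ) * Real.exp k ≤ Real.exp 1 * (k : ℝ) ^ (k + 1) := by
  induction k, hk using Nat.le_induction with
  | base => simp
  | succ k hk ih =>
    have hk0 : (0 : ℝ) < k := by exact_mod_cast hk
    have h1 : (k : ℝ) * Real.exp (1 / ((k : ℝ) + 1)) ≤ k + 1 := by
      have h := Real.one_sub_le_exp_neg (1 / ((k : ℝ) + 1))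
      rw [Real.exp_neg] at h
      have hp := Real.exp_pos (1 / ((k : ℝ) + 1))
      have e : 1 - 1 / ((k : ℝ) + 1) = k / (k + 1) := by field_simp; ring
      rw [e, div_le_iff₀ (by positivity), inv_mul_eq_div, le_div_iff₀ hp] at h
      exact h
    have h2 : (k : ℝ) ^ (k + 1) * Real.exp 1 ≤ ((k : ℝ) + 1) ^ (k + 1) := by
      calc _ = ((k : ℝ) * Real.exp (1 / ((k : ℝ) + 1))) ^ (k + 1) := by
            rw [mul_pow, ← Real.exp_nat_mul]
            congr 2
            push_cast
            field_simp
        _ ≤ _ := by gcongr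
    rw [Nat.factorial_succ]
    push_cast
    rw [Real.exp_add]
    calc ((k : ℝ) + 1) * k.factorial * (Real.exp k * Real.exp 1)
        = ((k : ℝ) + 1) * Real.exp 1 * (k.factorial * Real.exp k) := by ring
      _ ≤ ((k : ℝ) + 1) * Real.exp 1 * (Real.exp 1 * (k : ℝ) ^ (k + 1)) := by gcongr
      _ = ((k : ℝ) + 1) * Real.exp 1 * ((k : ℝ) ^ (k + 1) * Real.exp 1) := by ring
      _ ≤ ((k : ℝ) + 1) * Real.exp 1 * ((k : ℝ) + 1) ^ (k + 1) := by gcongr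
      _ = _ := by ring

/-- Taylor coefficients of functions in the Fock space: Cauchy's estimate on the circle of radius
`(k / α) ^ (1 / α)`. -/
theorem exists_norm_iteratedDeriv_le_fockMass (hα : 1 < α) (hP : 0 < P) :
    ∃ (A : ℕ) (C : ℝ), 0 < C ∧ ∀ f : ℂ → ℂ, Differentiable ℂ f → fockMass α P f ≠ ∞ →
      ∀ k, ‖iteratedDeriv k f 0‖ ≤ C * (((k : ℝ) + 1) ^ A * coeffWeight α k) *
        ((fockMass α P f) ^ (1 / P)).toReal := by
  obtain ⟨A, C, hC, h⟩ := exists_norm_le_fockMass hα hP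
  refine ⟨A + 1, C * Real.exp 1, by positivity, fun f hf hI k => ?_⟩
  set N : ℝ := ((fockMass α P f) ^ (1 / P)).toReal with hN
  have hN0 : 0 ≤ N := ENNReal.toReal_nonneg
  have hα0 : 0 < α := by linarith
  rcases Nat.eq_zero_or_pos k with rfl | hk
  · have h0 := h f hf hI 0
    rw [norm_zero, Real.zero_rpow hα0.ne'] at h0
    simp only [add_zero, one_pow, mul_one, Real.exp_zero] at h0
    simp only [iteratedDeriv_zero, coeffWeight, facWeight_zero, Nat.cast_zero, zero_add, one_pow,
      mul_one]
    refine h0.trans ?_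
    gcongr
    exact le_mul_of_one_le_right hC.le (Real.one_le_exp zero_le_one)
  have hk0 : (0 : ℝ) < k := by exact_mod_cast hk
  have hk1 : (1 : ℝ) ≤ k := by exact_mod_cast hk
  set r : ℝ := ((k : ℝ) / α) ^ (1 / α) with hr
  have hr0 : 0 < r := by positivity
  have hrα : r ^ α = k / α := by
    rw [hr, ← Real.rpow_mul (by positivity), one_div_mul_cancel hα0.ne', Real.rpow_one]
  have hrk : r ≤ k := by
    calc r ≤ (k : ℝ) ^ (1 / α) := by
          refine Real.rpow_le_rpow (by positivity) ?_ (by positivity)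
          exact div_le_self hk0.le hα.le
      _ ≤ (k : ℝ) ^ (1 : ℝ) :=
          Real.rpow_le_rpow_of_exponent_le hk1 ((div_le_one hα0).2 hα.le)
      _ = k := Real.rpow_one _
  have hcauchy := Complex.norm_iteratedDeriv_le_of_forall_mem_sphere_norm_le (c := 0) k hr0
    hf.diffContOnCl (C := C * (1 + r) ^ A * Real.exp (k / α) * N) (fun z hz => by
      rw [mem_sphere_iff_norm, sub_zero] at hz
      have := h f hf hI z
      rwa [hz, hrα] at this)
  refine hcauchy.trans ?_
  set D : ℝ := α ^ (1 / α) with hD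
  have hfac : (0 : ℝ) < k.factorial := by exact_mod_cast k.factorial_pos
  have h1 : Real.exp (k / α) ≤
      D ^ k * r ^ k * (Real.exp 1 * k * ((k.factorial : ℝ) ^ (1 / α))⁻¹) := by
    have e1 : D ^ k * r ^ k = ((k : ℝ) ^ k) ^ (1 / α) := by
      rw [← mul_pow, hD, hr, ← Real.mul_rpow hα0.le (by positivity), mul_div_cancel₀ _ hα0.ne',
        ← Real.rpow_natCast, ← Real.rpow_natCast, ← Real.rpow_mul hk0.le, ← Real.rpow_mul hk0.le,
        mul_comm]
    have e2 : Real.exp (k / α) = (Real.exp k) ^ (1 / α) := by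
      rw [← Real.exp_mul]; congr 1; ring
    have h2 : Real.exp k ≤ (k : ℝ) ^ k * (Real.exp 1 * k / k.factorial) := by
      rw [← mul_div_assoc, le_div_iff₀ hfac, mul_comm]
      refine (factorial_mul_exp_le hk).trans_eq ?_
      ring
    have h3 : (Real.exp 1 * k) ^ (1 / α) ≤ Real.exp 1 * k := by
      have : 1 ≤ Real.exp 1 * k :=
        one_le_mul_of_one_le_of_one_le (Real.one_le_exp zero_le_one) hk1
      calc _ ≤ (Real.exp 1 * k) ^ (1 : ℝ) :=
            Real.rpow_le_rpow_of_exponent_le this ((div_le_one hα0).2 hα.le)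
        _ = _ := Real.rpow_one _
    rw [e1, e2]
    calc _ ≤ ((k : ℝ) ^ k * (Real.exp 1 * k / k.factorial)) ^ (1 / α) :=
          Real.rpow_le_rpow (by positivity) h2 (by positivity)
      _ = ((k : ℝ) ^ k) ^ (1 / α) *
          ((Real.exp 1 * k) ^ (1 / α) * ((k.factorial : ℝ) ^ (1 / α))⁻¹) := by
          rw [Real.mul_rpow (by positivity) (by positivity),
            Real.div_rpow (by positivity) hfac.le]
          congr 1
      _ ≤ _ := by gcongr
  have h4 : (k.factorial : ℝ) * ((k.factorial : ℝ) ^ (1 / α))⁻¹ =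
      (k.factorial : ℝ) ^ (1 - 1 / α) := by
    rw [Real.rpow_sub hfac, Real.rpow_one]; rfl
  rw [div_le_iff₀ (by positivity)]
  calc (k.factorial : ℝ) * (C * (1 + r) ^ A * Real.exp (k / α) * N)
      ≤ (k.factorial : ℝ) * (C * ((k : ℝ) + 1) ^ A * (D ^ k * r ^ k *
          (Real.exp 1 * ((k : ℝ) + 1) * ((k.factorial : ℝ) ^ (1 / α))⁻¹)) * N) := by
        have hk2 : 1 + r ≤ (k : ℝ) + 1 := by linarith
        have h5 : Real.exp (k / α) ≤ D ^ k * r ^ k *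
            (Real.exp 1 * ((k : ℝ) + 1) * ((k.factorial : ℝ) ^ (1 / α))⁻¹) := by
          refine h1.trans ?_
          gcongr
          linarith
        gcongr
    _ = C * Real.exp 1 * (((k : ℝ) + 1) ^ (A + 1) * (((k.factorial : ℝ) *
          ((k.factorial : ℝ) ^ (1 / α))⁻¹) * D ^ k)) * N * r ^ k := by ring
    _ = _ := by rw [h4]; rfl

/-- The size of a monomial, from `t ^ m / m! ≤ exp t` at `t = α r ^ α`. -/
theorem pow_mul_exp_neg_rpow_le (hα : 1 < α) {r : ℝ} (hr : 0 ≤ r) (m : ℕ) :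
    r ^ m * Real.exp (-r ^ α) ≤ (m.factorial : ℝ) ^ (1 / α) / (α ^ (1 / α)) ^ m := by
  have hα0 : 0 < α := by linarith
  have hfac : (0 : ℝ) < m.factorial := by exact_mod_cast m.factorial_pos
  have h1 := Real.pow_div_factorial_le_exp (α * r ^ α) (by positivity) m
  rw [div_le_iff₀ hfac] at h1
  have h2 := Real.rpow_le_rpow (by positivity) h1 (z := 1 / α) (by positivity)
  have e1 : ((α * r ^ α) ^ m) ^ (1 / α) = (α ^ (1 / α)) ^ m * r ^ m := by
    rw [← Real.rpow_natCast, ← Real.rpow_mul (by positivity), mul_comm (m : ℝ),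
      Real.rpow_mul (by positivity), Real.rpow_natCast, Real.mul_rpow hα0.le (by positivity),
      ← Real.rpow_mul hr, mul_one_div_cancel hα0.ne', Real.rpow_one, mul_pow]
  rw [e1, Real.mul_rpow (Real.exp_pos _).le hfac.le, ← Real.exp_mul] at h2
  rw [show α * r ^ α * (1 / α) = r ^ α by field_simp] at h2
  rw [le_div_iff₀ (by positivity), Real.exp_neg]
  have hp := Real.exp_pos (r ^ α)
  rw [mul_assoc, mul_comm, mul_assoc, inv_mul_le_iff₀ hp]
  exact h2

theorem factorial_add_le (m Q : ℕ) :
    ((m + Q).factorial : ℝ) ≤ (((Q : ℝ) + 1) * ((m : ℝ) + 1)) ^ Q * m.factorial := by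
  have h : (m + Q).factorial ≤ ((Q + 1) * (m + 1)) ^ Q * m.factorial := by
    rw [← Nat.factorial_mul_ascFactorial, mul_comm]
    gcongr
    refine (Nat.ascFactorial_le_pow_add _ _).trans ?_
    gcongr
    nlinarith
  exact_mod_cast h

theorem monomial_weight_le (hα : 1 < α) (Q m : ℕ) {r : ℝ} (hr : 0 ≤ r) :
    r ^ m / m.factorial * Real.exp (-r ^ α) ≤
      2 ^ Q * (1 + ((Q : ℝ) + 1) ^ Q) * (((m : ℝ) + 1) ^ Q / coeffWeight α m) *
        ((1 + r) ^ Q)⁻¹ := by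
  have hα0 : 0 < α := by linarith
  have hfac : (0 : ℝ) < m.factorial := by exact_mod_cast m.factorial_pos
  set D : ℝ := α ^ (1 / α) with hD
  have hD1 : 1 ≤ D := one_le_rpow_inv_self hα
  have h1 : (1 + r) ^ Q ≤ 2 ^ Q * (1 + r ^ Q) := by
    rcases le_total r 1 with h | h
    · calc (1 + r) ^ Q ≤ 2 ^ Q := by gcongr; linarith
        _ ≤ _ := le_mul_of_one_le_right (by positivity) (by simp; positivity)
    · calc (1 + r) ^ Q ≤ (2 * r) ^ Q := by gcongr; linarith
        _ = 2 ^ Q * r ^ Q := mul_pow _ _ _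
        _ ≤ _ := by gcongr; linarith
  have h2 := pow_mul_exp_neg_rpow_le hα hr m
  have h3 := pow_mul_exp_neg_rpow_le hα hr (m + Q)
  have h4 : ((m + Q).factorial : ℝ) ^ (1 / α) / D ^ (m + Q) ≤
      (((Q : ℝ) + 1) * ((m : ℝ) + 1)) ^ Q * ((m.factorial : ℝ) ^ (1 / α) / D ^ m) := by
    rw [← mul_div_assoc]
    gcongr ?_ / ?_
    · calc _ ≤ ((((Q : ℝ) + 1) * ((m : ℝ) + 1)) ^ Q * m.factorial) ^ (1 / α) :=
            Real.rpow_le_rpow (by positivity) (factorial_add_le m Q) (by positivity)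
        _ = ((((Q : ℝ) + 1) * ((m : ℝ) + 1)) ^ Q) ^ (1 / α) * (m.factorial : ℝ) ^ (1 / α) :=
            Real.mul_rpow (by positivity) hfac.le
        _ ≤ _ := by
            gcongr
            have : 1 ≤ (((Q : ℝ) + 1) * ((m : ℝ) + 1)) ^ Q :=
              one_le_pow₀ (one_le_mul_of_one_le_of_one_le (by simp) (by simp))
            calc _ ≤ ((((Q : ℝ) + 1) * ((m : ℝ) + 1)) ^ Q) ^ (1 : ℝ) :=
                  Real.rpow_le_rpow_of_exponent_le this ((div_le_one hα0).2 hα.le)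
              _ = _ := Real.rpow_one _
    · exact pow_le_pow_right₀ hD1 (Nat.le_add_right _ _)
  have h5 : (m.factorial : ℝ) ^ (1 / α) / D ^ m / m.factorial = (coeffWeight α m)⁻¹ := by
    unfold coeffWeight facWeight
    rw [Real.rpow_sub hfac, Real.rpow_one, ← hD]
    have : 0 < (m.factorial : ℝ) ^ (1 / α) := by positivity
    field_simp
  set X : ℝ := (m.factorial : ℝ) ^ (1 / α) / D ^ m with hX
  have hX0 : 0 ≤ X := by positivity
  have h6 : (1 + r) ^ Q * (r ^ m * Real.exp (-r ^ α)) ≤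
      2 ^ Q * (1 + ((Q : ℝ) + 1) ^ Q) * ((m : ℝ) + 1) ^ Q * X := by
    have hm : 1 ≤ ((m : ℝ) + 1) ^ Q := one_le_pow₀ (by simp)
    calc _ ≤ 2 ^ Q * (1 + r ^ Q) * (r ^ m * Real.exp (-r ^ α)) := by gcongr
      _ = 2 ^ Q * (r ^ m * Real.exp (-r ^ α) + r ^ (m + Q) * Real.exp (-r ^ α)) := by
          rw [pow_add]; ring
      _ ≤ 2 ^ Q * (((m : ℝ) + 1) ^ Q * X + (((Q : ℝ) + 1) * ((m : ℝ) + 1)) ^ Q * X) := by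
          gcongr 2 ^ Q * (?_ + ?_)
          · exact h2.trans (le_mul_of_one_le_left hX0 hm)
          · exact h3.trans h4
      _ = _ := by rw [mul_pow]; ring
  rw [← div_eq_mul_inv, le_div_iff₀ (by positivity)]
  calc _ = (1 + r) ^ Q * (r ^ m * Real.exp (-r ^ α)) / m.factorial := by ring
    _ ≤ 2 ^ Q * (1 + ((Q : ℝ) + 1) ^ Q) * ((m : ℝ) + 1) ^ Q * X / m.factorial := by gcongr
    _ = 2 ^ Q * (1 + ((Q : ℝ) + 1) ^ Q) * ((m : ℝ) + 1) ^ Q * (X / m.factorial) := by ring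
    _ = _ := by rw [h5]; ring

/-- The norm of an entire function is controlled by a weighted `ℓ¹` norm of its Taylor coefficients;
this is a substitute for the triangle inequality that also works when `P < 1`. -/
theorem exists_fockMass_le_tsum (hα : 1 < α) (hP : 0 < P) :
    ∃ (Q : ℕ) (C : ℝ≥0∞), C ≠ ∞ ∧ ∀ h : ℂ → ℂ, Differentiable ℂ h →
      (fockMass α P h) ^ (1 / P) ≤ C * ∑' m, ‖iteratedDeriv m h 0‖ₑ *
        ENNReal.ofReal (((m : ℝ) + 1) ^ Q / coeffWeight α m) := by
  obtain ⟨Q, hQ⟩ := exists_nat_gt (2 / P)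
  have hQP : 2 < Q * P := by rwa [div_lt_iff₀ hP] at hQ
  set K : ℝ := 2 ^ Q * (1 + ((Q : ℝ) + 1) ^ Q) with hK
  have hK0 : 0 < K := by positivity
  set J : ℝ≥0∞ := ∫⁻ z : ℂ, ENNReal.ofReal ((1 + ‖z‖) ^ (-(Q * P))) with hJ
  have hJfin : J < ∞ := finite_integral_one_add_norm (by simpa using hQP)
  refine ⟨Q, ENNReal.ofReal K * J ^ (1 / P), ENNReal.mul_ne_top ENNReal.ofReal_ne_top
    (ENNReal.rpow_ne_top_of_nonneg (by positivity) hJfin.ne), fun h hh => ?_⟩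
  set T : ℝ≥0∞ := ∑' m, ‖iteratedDeriv m h 0‖ₑ *
    ENNReal.ofReal (((m : ℝ) + 1) ^ Q / coeffWeight α m) with hT
  have hpt : ∀ z, ‖h z‖ₑ * ENNReal.ofReal (Real.exp (-‖z‖ ^ α)) ≤
      T * ENNReal.ofReal (K * ((1 + ‖z‖) ^ Q)⁻¹) := by
    intro z
    have hs := Complex.hasSum_taylorSeries_of_entire hh 0 z
    have h1 : ‖h z‖ₑ ≤ ∑' m, ‖iteratedDeriv m h 0‖ₑ *
        ENNReal.ofReal (‖z‖ ^ m / m.factorial) := by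
      refine le_of_tendsto (hs.tendsto_sum_nat.enorm) (Filter.Eventually.of_forall fun n => ?_)
      refine (enorm_sum_le _ _).trans ((Finset.sum_le_sum fun m _ => ?_).trans
        (ENNReal.sum_le_tsum _))
      rw [← ofReal_norm, ← ofReal_norm (iteratedDeriv m h 0),
        ← ENNReal.ofReal_mul (norm_nonneg _)]
      refine ENNReal.ofReal_le_ofReal (le_of_eq ?_)
      rw [sub_zero, norm_smul, norm_smul, norm_inv, norm_pow, Complex.norm_natCast]
      ring
    calc _ ≤ (∑' m, ‖iteratedDeriv m h 0‖ₑ * ENNReal.ofReal (‖z‖ ^ m / m.factorial)) *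
          ENNReal.ofReal (Real.exp (-‖z‖ ^ α)) := by gcongr
      _ ≤ _ := by
          rw [hT, ← ENNReal.tsum_mul_right, ← ENNReal.tsum_mul_right]
          refine ENNReal.tsum_le_tsum fun m => ?_
          have hw := coeffWeight_pos hα m
          rw [mul_assoc, mul_assoc, ← ENNReal.ofReal_mul (by positivity),
            ← ENNReal.ofReal_mul (by positivity)]
          refine mul_le_mul' le_rfl (ENNReal.ofReal_le_ofReal ?_)
          refine (monomial_weight_le hα Q m (norm_nonneg z)).trans_eq ?_
          ring
  have hint : fockMass α P h ≤ T ^ P * (ENNReal.ofReal (K ^ P) * J) := by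
    rw [hJ, ← lintegral_const_mul' _ _ ENNReal.ofReal_ne_top]
    calc _ ≤ ∫⁻ z : ℂ, T ^ P * (ENNReal.ofReal (K ^ P) *
          ENNReal.ofReal ((1 + ‖z‖) ^ (-(Q * P)))) := by
          refine lintegral_mono fun z => ?_
          have h1 := ENNReal.rpow_le_rpow (hpt z) hP.le
          rw [ENNReal.mul_rpow_of_nonneg _ _ hP.le, ENNReal.mul_rpow_of_nonneg _ _ hP.le,
            ENNReal.ofReal_rpow_of_pos (Real.exp_pos _), ← Real.exp_mul,
            ENNReal.ofReal_rpow_of_nonneg (by positivity) hP.le,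
            Real.mul_rpow hK0.le (by positivity), ENNReal.ofReal_mul (by positivity)] at h1
          have e1 : -‖z‖ ^ α * P = -P * ‖z‖ ^ α := by ring
          have e2 : (((1 + ‖z‖) ^ Q)⁻¹) ^ P = (1 + ‖z‖) ^ (-(Q * P)) := by
            rw [← Real.rpow_natCast, ← Real.rpow_neg (by positivity),
              ← Real.rpow_mul (by positivity)]
            congr 1; ring
          rw [e1, e2] at h1
          exact h1
      _ = _ := by
          rw [lintegral_const_mul]
          exact (ENNReal.measurable_ofReal.comp (by fun_prop)).const_mul _
  calc _ ≤ (T ^ P * (ENNReal.ofReal (K ^ P) * J)) ^ (1 / P) :=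
        ENNReal.rpow_le_rpow hint (by positivity)
    _ = _ := by
        rw [ENNReal.mul_rpow_of_nonneg _ _ (by positivity),
          ENNReal.mul_rpow_of_nonneg _ _ (by positivity), ← ENNReal.rpow_mul,
          mul_one_div_cancel hP.ne', ENNReal.rpow_one, ENNReal.ofReal_rpow_of_nonneg
          (by positivity) (by positivity), ← Real.rpow_mul hK0.le, mul_one_div_cancel hP.ne',
          Real.rpow_one, mul_comm]

end Coefficients

/-! ### The Volterra operator maps the Fock space into itself -/

theorem hasDerivAt_volterra {f : ℂ → ℂ} (hf : Differentiable ℂ f) (z : ℂ) :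
    HasDerivAt (volterra f) (f z) z := by
  obtain ⟨F, hF⟩ := hf.isExactOn_univ
  have hF' : ∀ z, HasDerivAt F (f z) z := fun z => hF z (Set.mem_univ z)
  have e : volterra f = fun z => F z - F 0 := by
    funext z
    have h : ∀ t ∈ Set.uIcc (0 : ℝ) 1,
        HasDerivAt (fun t : ℝ => F ((t : ℂ) * z)) (f ((t : ℂ) * z) * z) t := by
      intro t _
      have h1 : HasDerivAt (fun t : ℝ => (t : ℂ) * z) z t := by
        simpa using (Complex.ofRealCLM.hasDerivAt (x := t)).mul_const z
      exact (hF' ((t : ℂ) * z)).comp t h1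
    unfold volterra
    rw [intervalIntegral.integral_eq_sub_of_hasDerivAt h]
    · simp
    · have := hf.continuous
      exact Continuous.intervalIntegrable (by fun_prop) _ _
  rw [e]
  exact (hF' z).sub_const _

theorem differentiable_volterra {f : ℂ → ℂ} (hf : Differentiable ℂ f) :
    Differentiable ℂ (volterra f) := fun z => (hasDerivAt_volterra hf z).differentiableAt

theorem deriv_volterra {f : ℂ → ℂ} (hf : Differentiable ℂ f) : deriv (volterra f) = f :=
  funext fun z => (hasDerivAt_volterra hf z).deriv

theorem volterra_apply_zero (f : ℂ → ℂ) : volterra f 0 = 0 := by simp [volterra]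

theorem iteratedDeriv_succ_volterra {f : ℂ → ℂ} (hf : Differentiable ℂ f) (k : ℕ) :
    iteratedDeriv (k + 1) (volterra f) = iteratedDeriv k f := by
  rw [iteratedDeriv_succ', deriv_volterra hf]

theorem iteratedDeriv_dilation {h : ℂ → ℂ} (hh : Differentiable ℂ h) (r : ℂ) (k : ℕ) :
    iteratedDeriv k (fun z => h (r * z)) 0 = r ^ k * iteratedDeriv k h 0 := by
  have := iteratedDeriv_comp_const_mul (n := k) (hh.contDiff (n := k)) r
  simpa using congrFun this 0

theorem tsum_enorm_iteratedDeriv_dilation_ne_top {α : ℝ} (hα : 1 < α) {h : ℂ → ℂ}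
    (hh : Differentiable ℂ h) {A : ℕ} {C : ℝ}
    (hb : ∀ k, ‖iteratedDeriv k h 0‖ ≤ C * (((k : ℝ) + 1) ^ A * coeffWeight α k))
    {r : ℝ} (hr0 : 0 < r) (hr1 : r < 1) (Q : ℕ) :
    ∑' m, ‖iteratedDeriv m (fun z => h (r * z)) 0‖ₑ *
      ENNReal.ofReal (((m : ℝ) + 1) ^ Q / coeffWeight α m) ≠ ∞ := by
  have hs : Summable fun m : ℕ => C * (((m : ℝ) + 1) ^ (A + Q) * r ^ m) := by
    have h1 := summable_pow_mul_geometric_of_norm_lt_one (R := ℝ) (A + Q) (r := r)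
      (by rwa [Real.norm_of_nonneg hr0.le])
    have h2 := ((summable_nat_add_iff 1).2 h1).mul_left (C * r⁻¹)
    refine h2.congr fun m => ?_
    push_cast
    rw [pow_succ r m]
    field_simp
  refine ne_top_of_le_ne_top hs.tsum_ofReal_ne_top (ENNReal.tsum_le_tsum fun m => ?_)
  have hw := coeffWeight_pos hα m
  rw [← ofReal_norm, ← ENNReal.ofReal_mul (norm_nonneg _), iteratedDeriv_dilation hh, norm_mul,
    norm_pow, Complex.norm_real, Real.norm_of_nonneg hr0.le]
  refine ENNReal.ofReal_le_ofReal ?_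
  calc _ ≤ r ^ m * (C * (((m : ℝ) + 1) ^ A * coeffWeight α m)) *
        (((m : ℝ) + 1) ^ Q / coeffWeight α m) := by
        gcongr
        exact hb m
    _ = _ := by field_simp; ring

theorem ennreal_add_rpow_le {P : ℝ} (hP : 0 ≤ P) (x y : ℝ≥0∞) :
    (x + y) ^ P ≤ 2 ^ P * (x ^ P + y ^ P) := by
  calc (x + y) ^ P ≤ (2 * max x y) ^ P := by
        refine ENNReal.rpow_le_rpow ?_ hP
        rw [two_mul]
        exact add_le_add (le_max_left _ _) (le_max_right _ _)
    _ = 2 ^ P * (max x y) ^ P := ENNReal.mul_rpow_of_nonneg _ _ hP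
    _ ≤ _ := by
        gcongr
        rcases le_total x y with hxy | hxy
        · rw [max_eq_right hxy]; exact le_add_self
        · rw [max_eq_left hxy]; exact le_self_add

/-- A substitute for Minkowski's inequality valid for all `P > 0`, at the price of the factors
`L ^ i`. -/
theorem exists_tsum_rpow_le {P : ℝ} (hP : 0 < P) {L : ℝ≥0∞} (hL : 1 < L) (hL' : L ≠ ∞) :
    ∃ C : ℝ≥0∞, C ≠ ∞ ∧ ∀ a : ℕ → ℝ≥0∞, (∑' i, a i) ^ P ≤ C * ∑' i, L ^ i * a i ^ P := by
  set q : ℝ≥0∞ := L⁻¹ ^ (1 / P) with hq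
  have hq1 : q < 1 := ENNReal.rpow_lt_one (ENNReal.inv_lt_one.2 hL) (by positivity)
  refine ⟨((1 - q)⁻¹) ^ P, ENNReal.rpow_ne_top_of_nonneg hP.le
    (ENNReal.inv_ne_top.2 (tsub_pos_of_lt hq1).ne'), fun a => ?_⟩
  set S : ℝ≥0∞ := ∑' i, L ^ i * a i ^ P with hS
  have hL0 : L ≠ 0 := (zero_lt_one.trans hL).ne'
  have h1 : ∀ i, a i ≤ S ^ (1 / P) * q ^ i := by
    intro i
    have h2 : a i ^ P ≤ S / L ^ i := by
      rw [ENNReal.le_div_iff_mul_le (Or.inl (pow_ne_zero _ hL0)) (Or.inl (ENNReal.pow_ne_top hL')),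
        mul_comm]
      exact ENNReal.le_tsum (f := fun i => L ^ i * a i ^ P) i
    have h3 := ENNReal.rpow_le_rpow h2 (z := 1 / P) (by positivity)
    rw [← ENNReal.rpow_mul, mul_one_div_cancel hP.ne', ENNReal.rpow_one, div_eq_mul_inv,
      ENNReal.mul_rpow_of_nonneg _ _ (by positivity), ENNReal.inv_pow] at h3
    refine h3.trans_eq ?_
    rw [hq, ← ENNReal.rpow_natCast, ← ENNReal.rpow_natCast, ← ENNReal.rpow_mul,
      ← ENNReal.rpow_mul, mul_comm (1 / P)]
  calc (∑' i, a i) ^ P ≤ (∑' i, S ^ (1 / P) * q ^ i) ^ P :=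
        ENNReal.rpow_le_rpow (ENNReal.tsum_le_tsum h1) hP.le
    _ = _ := by
        rw [ENNReal.tsum_mul_left, ENNReal.tsum_geometric, ENNReal.mul_rpow_of_nonneg _ _ hP.le,
          ← ENNReal.rpow_mul, one_div_mul_cancel hP.ne', ENNReal.rpow_one, mul_comm]

theorem fockMass_dilation_ne_top {α P : ℝ} (hα : 1 < α) (hP : 0 < P) {h : ℂ → ℂ}
    (hh : Differentiable ℂ h) {A : ℕ} {C : ℝ}
    (hb : ∀ k, ‖iteratedDeriv k h 0‖ ≤ C * (((k : ℝ) + 1) ^ A * coeffWeight α k))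
    {r : ℝ} (hr0 : 0 < r) (hr1 : r < 1) : fockMass α P (fun z => h (r * z)) ≠ ∞ := by
  obtain ⟨Q, K, hK, hbound⟩ := exists_fockMass_le_tsum hα hP
  have hle := hbound (fun z => h (r * z)) (hh.comp (differentiable_id.const_mul _))
  intro htop
  rw [htop, ENNReal.top_rpow_of_pos (by positivity)] at hle
  exact ENNReal.mul_ne_top hK (tsum_enorm_iteratedDeriv_dilation_ne_top hα hh hb hr0 hr1 Q)
    (top_le_iff.1 hle)

section Volterra

variable {α P : ℝ}

theorem kernel_pointwise_le (hα : 1 < α) (hP : 0 < P) {δ : ℝ} (hδ0 : 0 < δ) (hδ1 : δ ≤ 1 / 2)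
    {x y : ℝ} (hx : 0 < x) (hy : 0 < y) (hyx : y ≤ (1 - δ / 4) * x) :
    (δ * x) ^ (P - 2) * Real.exp (-P * x ^ α) ≤
      4 ^ P * δ ^ (P * (1 - 1 / α)) * Real.exp (-P * y ^ α) / (δ * y) ^ 2 := by
  have hα0 : 0 < α := by linarith
  have hyx' : y ≤ x := hyx.trans (mul_le_of_le_one_left hx.le (by linarith))
  have h1 : y ^ α ≤ (1 - δ / 4) * x ^ α := by
    calc y ^ α ≤ ((1 - δ / 4) * x) ^ α := Real.rpow_le_rpow hy.le hyx hα0.le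
      _ = (1 - δ / 4) ^ α * x ^ α := Real.mul_rpow (by linarith) hx.le
      _ ≤ (1 - δ / 4) ^ (1 : ℝ) * x ^ α := by
          refine mul_le_mul_of_nonneg_right ?_ (by positivity)
          exact Real.rpow_le_rpow_of_exponent_ge (by linarith) (by linarith) hα.le
      _ = _ := by rw [Real.rpow_one]
  -- the factor `exp (-P δ x ^ α / 4)` gained from `y ≤ (1 - δ / 4) x` is a function of `s` alone
  set s : ℝ := δ ^ (1 / α) * x with hs
  have hs0 : 0 < s := by positivity
  have hsα : s ^ α = δ * x ^ α := by
    rw [hs, Real.mul_rpow (by positivity) hx.le, ← Real.rpow_mul hδ0.le,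
      one_div_mul_cancel hα0.ne', Real.rpow_one]
  have hsδ : δ * x = δ ^ (1 - 1 / α) * s := by
    rw [hs, ← mul_assoc, ← Real.rpow_add hδ0, sub_add_cancel, Real.rpow_one]
  have h2 : s ≤ 4 * Real.exp (s ^ α / 4) := by
    have h3 : s ≤ 1 + s ^ α := by
      rcases le_total s 1 with h | h
      · have : 0 ≤ s ^ α := by positivity
        linarith
      · have : s ^ (1 : ℝ) ≤ s ^ α := Real.rpow_le_rpow_of_exponent_le h hα.le
        rw [Real.rpow_one] at this
        linarith
    have := Real.add_one_le_exp (s ^ α / 4)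
    linarith
  have h3 : s ^ P * Real.exp (-P * (s ^ α / 4)) ≤ 4 ^ P := by
    have := Real.rpow_le_rpow hs0.le h2 hP.le
    rw [Real.mul_rpow (by norm_num) (Real.exp_pos _).le, ← Real.exp_mul] at this
    calc _ ≤ 4 ^ P * Real.exp (s ^ α / 4 * P) * Real.exp (-P * (s ^ α / 4)) := by gcongr
      _ = _ := by rw [mul_assoc, ← Real.exp_add]; ring_nf; simp
  have h4 : Real.exp (-P * x ^ α) ≤ Real.exp (-P * y ^ α) * Real.exp (-P * (s ^ α / 4)) := by
    rw [← Real.exp_add, hsα]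
    refine Real.exp_le_exp.2 ?_
    nlinarith
  have h5 : (δ * x) ^ (P - 2) = δ ^ (P * (1 - 1 / α)) * s ^ P / (δ * x) ^ 2 := by
    rw [Real.rpow_sub (by positivity), Real.rpow_two]
    congr 1
    rw [hsδ, Real.mul_rpow (by positivity) hs0.le, ← Real.rpow_mul hδ0.le, mul_comm P]
  rw [h5]
  calc _ ≤ δ ^ (P * (1 - 1 / α)) * s ^ P / (δ * y) ^ 2 *
        (Real.exp (-P * y ^ α) * Real.exp (-P * (s ^ α / 4))) := by gcongr
    _ = δ ^ (P * (1 - 1 / α)) * (s ^ P * Real.exp (-P * (s ^ α / 4))) *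
        Real.exp (-P * y ^ α) / (δ * y) ^ 2 := by ring
    _ ≤ δ ^ (P * (1 - 1 / α)) * 4 ^ P * Real.exp (-P * y ^ α) / (δ * y) ^ 2 := by gcongr
    _ = _ := by ring

/-- The points `z` whose disc of radius `3/4 δ ‖z‖` around `(1 - δ) z` contains `w` carry little
mass. -/
theorem lintegral_kernel_le (hα : 1 < α) (hP : 0 < P) {δ : ℝ} (hδ0 : 0 < δ) (hδ1 : δ ≤ 1 / 2)
    (w : ℂ) :
    ∫⁻ z, {z : ℂ | ‖w - (1 - δ) * z‖ < 3 / 4 * δ * ‖z‖}.indicator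
      (fun z => ENNReal.ofReal ((δ * ‖z‖) ^ (P - 2) * Real.exp (-P * ‖z‖ ^ α))) z ≤
      ENNReal.ofReal (144 * Real.pi * 4 ^ P * δ ^ (P * (1 - 1 / α)) * Real.exp (-P * ‖w‖ ^ α)) := by
  set S : Set ℂ := {z : ℂ | ‖w - (1 - δ) * z‖ < 3 / 4 * δ * ‖z‖} with hS
  have hpi := Real.pi_pos
  have hnorm : ∀ z : ℂ, ‖(1 - (δ : ℂ)) * z‖ = (1 - δ) * ‖z‖ := by
    intro z
    rw [norm_mul, ← Complex.ofReal_one, ← Complex.ofReal_sub, Complex.norm_real,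
      Real.norm_of_nonneg (by linarith)]
  have hup : ∀ z ∈ S, ‖w‖ ≤ (1 - δ / 4) * ‖z‖ := by
    intro z hz
    have h1 : ‖w‖ ≤ ‖w - (1 - δ) * z‖ + ‖(1 - (δ : ℂ)) * z‖ := by
      simpa using norm_add_le (w - (1 - δ) * z) ((1 - (δ : ℂ)) * z)
    rw [hnorm] at h1
    have h2 : ‖w - (1 - δ) * z‖ < 3 / 4 * δ * ‖z‖ := hz
    linarith
  have hpos : ∀ z ∈ S, 0 < ‖z‖ := by
    intro z hz
    have h2 : ‖w - (1 - δ) * z‖ < 3 / 4 * δ * ‖z‖ := hz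
    by_contra h
    have : ‖z‖ = 0 := le_antisymm (not_lt.1 h) (norm_nonneg _)
    rw [this, mul_zero] at h2
    exact absurd h2 (not_lt.2 (norm_nonneg _))
  have hlow : ∀ z ∈ S, ‖z‖ ≤ 8 * ‖w‖ := by
    intro z hz
    have h1 : ‖(1 - (δ : ℂ)) * z‖ ≤ ‖w‖ + ‖w - (1 - δ) * z‖ := by
      simpa using norm_sub_le w (w - (1 - δ) * z)
    rw [hnorm] at h1
    have h2 : ‖w - (1 - δ) * z‖ < 3 / 4 * δ * ‖z‖ := hz
    nlinarith [norm_nonneg z]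
  rcases eq_or_ne w 0 with rfl | hw
  · have : ∀ z, S.indicator (fun z : ℂ => ENNReal.ofReal ((δ * ‖z‖) ^ (P - 2) *
        Real.exp (-P * ‖z‖ ^ α))) z = 0 := by
      intro z
      refine Set.indicator_of_notMem (fun hz => ?_) _
      have h1 := hlow z hz
      have h2 := hpos z hz
      rw [norm_zero] at h1
      linarith
    simp_rw [this]
    simp
  have hw0 : 0 < ‖w‖ := norm_pos_iff.2 hw
  set V : ℝ := 4 ^ P * δ ^ (P * (1 - 1 / α)) * Real.exp (-P * ‖w‖ ^ α) / (δ * ‖w‖) ^ 2 with hV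
  have hV0 : 0 ≤ V := by positivity
  have hsub : S ⊆ Metric.ball (w / (1 - (δ : ℂ))) (12 * δ * ‖w‖) := by
    intro z hz
    have h2 : ‖w - (1 - δ) * z‖ < 3 / 4 * δ * ‖z‖ := hz
    have h3 := hlow z hz
    have hne : (1 - (δ : ℂ)) ≠ 0 := by
      rw [← Complex.ofReal_one, ← Complex.ofReal_sub]
      exact Complex.ofReal_ne_zero.2 (by linarith)
    rw [Metric.mem_ball, dist_comm, dist_eq_norm]
    have h4 : (1 - δ) * ‖w / (1 - (δ : ℂ)) - z‖ = ‖w - (1 - δ) * z‖ := by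
      rw [← hnorm]; congr 1; field_simp
    have h5 : 1 / 2 * ‖w / (1 - (δ : ℂ)) - z‖ ≤ (1 - δ) * ‖w / (1 - (δ : ℂ)) - z‖ :=
      mul_le_mul_of_nonneg_right (by linarith) (norm_nonneg _)
    nlinarith
  calc _ ≤ ∫⁻ z, (Metric.ball (w / (1 - (δ : ℂ))) (12 * δ * ‖w‖)).indicator
        (fun _ => ENNReal.ofReal V) z := by
        refine lintegral_mono fun z => ?_
        by_cases hz : z ∈ S
        · rw [Set.indicator_of_mem hz, Set.indicator_of_mem (hsub hz)]
          exact ENNReal.ofReal_le_ofReal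
            (kernel_pointwise_le hα hP hδ0 hδ1 (hpos z hz) hw0 (hup z hz))
        · rw [Set.indicator_of_notMem hz]; exact zero_le
    _ = ENNReal.ofReal V * ENNReal.ofReal (Real.pi * (12 * δ * ‖w‖) ^ 2) := by
        rw [lintegral_indicator_const measurableSet_ball, Complex.volume_ball,
          ← ENNReal.ofReal_pow (by positivity), mul_comm Real.pi,
          ENNReal.ofReal_mul (p := (12 * δ * ‖w‖) ^ 2) (by positivity)]
        congr 2
        rw [ENNReal.ofReal, Real.toNNReal_of_nonneg hpi.le]; rfl
    _ = _ := by
        rw [← ENNReal.ofReal_mul hV0, hV]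
        congr 1
        field_simp
        ring

theorem exists_enorm_increment_rpow_le (hP : 0 < P) :
    ∃ C : ℝ, 0 < C ∧ ∀ h : ℂ → ℂ, Differentiable ℂ h → ∀ δ : ℝ, 0 < δ → δ ≤ 1 / 2 → ∀ z : ℂ,
      ‖h ((1 - δ / 2) * z) - h ((1 - δ) * z)‖ₑ ^ P ≤ ENNReal.ofReal (C * (δ * ‖z‖) ^ (P - 2)) *
        ∫⁻ w in Metric.ball ((1 - δ) * z) (3 / 4 * δ * ‖z‖), ‖deriv h w‖ₑ ^ P := by
  obtain ⟨C, hC, hmean⟩ := exists_enorm_rpow_le_lintegral_ball hP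
  refine ⟨16 * C, by positivity, fun h hh δ hδ0 hδ1 z => ?_⟩
  rcases eq_or_ne z 0 with rfl | hz
  · simp [ENNReal.zero_rpow_of_pos hP]
  have hz0 : 0 < ‖z‖ := norm_pos_iff.2 hz
  set I := ∫⁻ w in Metric.ball ((1 - δ) * z) (3 / 4 * δ * ‖z‖), ‖deriv h w‖ₑ ^ P with hI
  rcases eq_or_ne I ∞ with hI' | hI'
  · rw [hI', ENNReal.mul_top (by simpa using by positivity)]; exact le_top
  have hIr : I = ENNReal.ofReal I.toReal := (ENNReal.ofReal_toReal hI').symm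
  have hI0 : 0 ≤ I.toReal := ENNReal.toReal_nonneg
  have hd : Differentiable ℂ (deriv h) := fun z => (hh.analyticAt z).deriv.differentiableAt
  set B : ℝ := (16 * C / (δ * ‖z‖) ^ 2 * I.toReal) ^ (1 / P) with hB
  have hlen : ‖(1 - (δ : ℂ) / 2) * z - (1 - δ) * z‖ = δ / 2 * ‖z‖ := by
    rw [show (1 - (δ : ℂ) / 2) * z - (1 - δ) * z = ((δ / 2 : ℝ) : ℂ) * z by push_cast; ring,
      norm_mul, Complex.norm_real, Real.norm_of_nonneg (by positivity)]
  have hder : ∀ x ∈ segment ℝ ((1 - (δ : ℂ)) * z) ((1 - (δ : ℂ) / 2) * z), ‖deriv h x‖ ≤ B := by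
    intro x hx
    have hx1 : ‖x - (1 - δ) * z‖ ≤ δ / 2 * ‖z‖ := by
      rw [← hlen]
      have := norm_sub_le_of_mem_segment hx
      simpa using this
    have hsub : Metric.ball x (δ * ‖z‖ / 4) ⊆ Metric.ball ((1 - δ) * z) (3 / 4 * δ * ‖z‖) := by
      refine Metric.ball_subset_ball' ?_
      rw [dist_eq_norm]
      linarith
    have h1 : ‖deriv h x‖ₑ ^ P ≤ ENNReal.ofReal (C / (δ * ‖z‖ / 4) ^ 2) * I := by
      refine (hmean _ hd x (δ * ‖z‖ / 4) (by positivity)).trans ?_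
      gcongr
      exact lintegral_mono_set hsub
    rw [hIr, ← ENNReal.ofReal_mul (by positivity), ← ofReal_norm,
      ENNReal.ofReal_rpow_of_nonneg (norm_nonneg _) hP.le,
      ENNReal.ofReal_le_ofReal_iff (by positivity)] at h1
    have h2 := Real.rpow_le_rpow (by positivity) h1 (z := 1 / P) (by positivity)
    rw [← Real.rpow_mul (norm_nonneg _), mul_one_div_cancel hP.ne', Real.rpow_one] at h2
    refine h2.trans_eq ?_
    rw [hB]
    congr 2
    field_simp
    norm_num
  have hB0 : 0 ≤ B := by positivity
  have h3 : ‖h ((1 - δ / 2) * z) - h ((1 - δ) * z)‖ ≤ B * (δ * ‖z‖) := by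
    have := (convex_segment ((1 - (δ : ℂ)) * z)
      ((1 - (δ : ℂ) / 2) * z)).norm_image_sub_le_of_norm_deriv_le (f := h) (fun x _ => hh x) hder (left_mem_segment ℝ _ _) (right_mem_segment ℝ _ _)
    rw [hlen] at this
    refine this.trans ?_
    gcongr
    linarith
  rw [hIr, ← ENNReal.ofReal_mul (by positivity), ← ofReal_norm,
    ENNReal.ofReal_rpow_of_nonneg (norm_nonneg _) hP.le]
  refine ENNReal.ofReal_le_ofReal ?_
  calc _ ≤ (B * (δ * ‖z‖)) ^ P := Real.rpow_le_rpow (norm_nonneg _) h3 hP.le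
    _ = 16 * C / (δ * ‖z‖) ^ 2 * I.toReal * (δ * ‖z‖) ^ P := by
        rw [Real.mul_rpow hB0 (by positivity), hB, ← Real.rpow_mul (by positivity),
          one_div_mul_cancel hP.ne', Real.rpow_one]
    _ = _ := by
        rw [Real.rpow_sub (by positivity), Real.rpow_two]; ring

theorem exists_fockMass_increment_le (hα : 1 < α) (hP : 0 < P) :
    ∃ C : ℝ, 0 < C ∧ ∀ h : ℂ → ℂ, Differentiable ℂ h → ∀ δ : ℝ, 0 < δ → δ ≤ 1 / 2 →
      fockMass α P (fun z => h ((1 - δ / 2) * z) - h ((1 - δ) * z)) ≤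
        ENNReal.ofReal (C * δ ^ (P * (1 - 1 / α))) * fockMass α P (deriv h) := by
  obtain ⟨C, hC, hinc⟩ := exists_enorm_increment_rpow_le hP
  have hpi := Real.pi_pos
  refine ⟨C * (144 * Real.pi * 4 ^ P), by positivity, fun h hh δ hδ0 hδ1 => ?_⟩
  have hd : Continuous (deriv h) :=
    (show Differentiable ℂ (deriv h) from
      fun z => (hh.analyticAt z).deriv.differentiableAt).continuous
  set k : ℂ → ℝ≥0∞ := fun z =>
    ENNReal.ofReal ((δ * ‖z‖) ^ (P - 2) * Real.exp (-P * ‖z‖ ^ α)) with hk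
  have hkm : Measurable k := ENNReal.measurable_ofReal.comp (by fun_prop)
  set S : Set (ℂ × ℂ) := {q | ‖q.2 - (1 - δ) * q.1‖ < 3 / 4 * δ * ‖q.1‖} with hS
  have hSm : MeasurableSet S := measurableSet_lt (by fun_prop) (by fun_prop)
  set F : ℂ × ℂ → ℝ≥0∞ := S.indicator fun q => k q.1 * ‖deriv h q.2‖ₑ ^ P with hF
  have hdm : Measurable fun w => ‖deriv h w‖ₑ ^ P := hd.measurable.enorm.pow_const P
  have hFm : Measurable F :=
    ((hkm.comp measurable_fst).mul (hdm.comp measurable_snd)).indicator hSm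
  have h1 : ∀ z, ‖h ((1 - δ / 2) * z) - h ((1 - δ) * z)‖ₑ ^ P *
      ENNReal.ofReal (Real.exp (-P * ‖z‖ ^ α)) ≤ ENNReal.ofReal C * ∫⁻ w, F (z, w) := by
    intro z
    have e : ∀ w, F (z, w) = k z * (Metric.ball ((1 - (δ : ℂ)) * z) (3 / 4 * δ * ‖z‖)).indicator
        (fun w => ‖deriv h w‖ₑ ^ P) w := by
      intro w
      simp only [hF, Set.indicator, hS, Set.mem_ofPred_eq, Metric.mem_ball, dist_eq_norm]
      split_ifs <;> simp
    simp_rw [e]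
    rw [lintegral_const_mul _ (hdm.indicator measurableSet_ball),
      lintegral_indicator measurableSet_ball]
    calc _ ≤ (ENNReal.ofReal (C * (δ * ‖z‖) ^ (P - 2)) *
          ∫⁻ w in Metric.ball ((1 - δ) * z) (3 / 4 * δ * ‖z‖), ‖deriv h w‖ₑ ^ P) *
          ENNReal.ofReal (Real.exp (-P * ‖z‖ ^ α)) := by
          gcongr
          exact hinc h hh δ hδ0 hδ1 z
      _ = _ := by
          simp only [hk]
          rw [ENNReal.ofReal_mul hC.le, ENNReal.ofReal_mul (p := (δ * ‖z‖) ^ (P - 2))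
            (by positivity)]
          ring
  calc _ ≤ ∫⁻ z, ENNReal.ofReal C * ∫⁻ w, F (z, w) := lintegral_mono h1
    _ = ENNReal.ofReal C * ∫⁻ w, ∫⁻ z, F (z, w) := by
        rw [lintegral_const_mul' _ _ ENNReal.ofReal_ne_top,
          lintegral_lintegral_swap (f := fun z w => F (z, w)) hFm.aemeasurable]
    _ ≤ ENNReal.ofReal C * ∫⁻ w, ENNReal.ofReal (144 * Real.pi * 4 ^ P * δ ^ (P * (1 - 1 / α))) *
          (‖deriv h w‖ₑ ^ P * ENNReal.ofReal (Real.exp (-P * ‖w‖ ^ α))) := by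
        gcongr with w
        have e : ∀ z, F (z, w) = ‖deriv h w‖ₑ ^ P *
            {z : ℂ | ‖w - (1 - δ) * z‖ < 3 / 4 * δ * ‖z‖}.indicator k z := by
          intro z
          simp only [hF, Set.indicator, hS, Set.mem_ofPred_eq]
          split_ifs
          · rw [mul_comm]
          · simp
        simp_rw [e]
        rw [lintegral_const_mul _ (hkm.indicator (measurableSet_lt (by fun_prop) (by fun_prop))),
          mul_left_comm, ← ENNReal.ofReal_mul (by positivity)]
        gcongr
        exact lintegral_kernel_le hα hP hδ0 hδ1 w
    _ = _ := by
        rw [lintegral_const_mul' _ _ ENNReal.ofReal_ne_top, ← mul_assoc, ← ENNReal.ofReal_mul hC.le]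
        unfold fockMass
        congr 2
        ring

/-- The Volterra operator preserves finiteness of the norm. The function `h = volterra f` is
written as `h (z / 2)`, which is harmless by its Taylor coefficients, plus the increments of `h`
between the points `(1 - 2⁻ⁱ) z`. -/
theorem fockMass_volterra_ne_top (hα : 1 < α) (hP : 0 < P) {f : ℂ → ℂ} (hf : Differentiable ℂ f)
    (hI : fockMass α P f ≠ ∞) : fockMass α P (volterra f) ≠ ∞ := by
  set h := volterra f with hh
  have hd : Differentiable ℂ h := differentiable_volterra hf
  have hα0 : 0 < α := by linarith
  have hβ : 0 < 1 - 1 / α := by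
    have := (div_lt_one hα0).2 hα
    linarith
  obtain ⟨C₁, hC₁, hinc⟩ := exists_fockMass_increment_le hα hP
  -- the mass of the increment at `δ` decays like `δ ^ e`; half of this exponent is spent on the
  -- factors `L ^ i`, so that the remaining series still converges
  set e : ℝ := P * (1 - 1 / α) with he
  have he0 : 0 < e := by positivity
  set L : ℝ := 2 ^ (e / 2) with hL
  have hL1 : 1 < L := Real.one_lt_rpow (by norm_num) (by positivity)
  have hL0 : 0 < L := by positivity
  obtain ⟨C₂, hC₂, hsum⟩ := exists_tsum_rpow_le hP (L := ENNReal.ofReal L)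
    (by rwa [ENNReal.one_lt_ofReal]) ENNReal.ofReal_ne_top
  set δ : ℕ → ℝ := fun i => (1 / 2) ^ (i + 1) with hδ
  have hδ0 : ∀ i, 0 < δ i := fun i => by positivity
  have hδ1 : ∀ i, δ i ≤ 1 / 2 := fun i => by
    simp only [hδ, pow_succ]
    exact mul_le_of_le_one_left (by norm_num) (pow_le_one₀ (by norm_num) (by norm_num))
  have hδs : ∀ i, δ (i + 1) = δ i / 2 := fun i => by simp only [hδ, pow_succ]; ring
  set a : ℕ → ℂ → ℝ≥0∞ := fun i z => ‖h ((1 - δ i / 2) * z) - h ((1 - δ i) * z)‖ₑ with ha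
  -- the points `(1 - δ i) z` run from `z / 2` to `z`
  have htele : ∀ z, ‖h z‖ₑ ≤ ‖h (((1 / 2 : ℝ) : ℂ) * z)‖ₑ + ∑' i, a i z := by
    intro z
    have hlim : Filter.Tendsto (fun n => h ((1 - δ n) * z)) Filter.atTop (nhds (h z)) := by
      have h1 : Filter.Tendsto δ Filter.atTop (nhds 0) :=
        (tendsto_pow_atTop_nhds_zero_of_lt_one (by norm_num) (by norm_num)).comp
          (Filter.tendsto_add_atTop_nat 1)
      have h2 : Filter.Tendsto (fun n => (1 - (δ n : ℂ)) * z) Filter.atTop (nhds z) := by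
        have := ((Complex.continuous_ofReal.tendsto 0).comp h1).const_sub 1 |>.mul_const z
        simpa using this
      exact (hd.continuous.tendsto z).comp h2
    refine le_of_tendsto hlim.enorm (Filter.Eventually.of_forall fun n => ?_)
    have h3 : h ((1 - δ n) * z) = h (((1 / 2 : ℝ) : ℂ) * z) +
        ∑ i ∈ Finset.range n, (h ((1 - δ i / 2) * z) - h ((1 - δ i) * z)) := by
      have h4 : ∀ i, h ((1 - δ i / 2) * z) = h ((1 - δ (i + 1)) * z) := fun i => by
        rw [hδs]; push_cast; rfl
      simp_rw [h4]
      rw [Finset.sum_range_sub (fun i => h ((1 - δ i) * z))]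
      have : (1 - (δ 0 : ℂ)) = ((1 / 2 : ℝ) : ℂ) := by simp only [hδ]; push_cast; norm_num
      rw [this]; ring
    rw [h3]
    refine (enorm_add_le _ _).trans (add_le_add le_rfl ?_)
    exact (enorm_sum_le _ _).trans (ENNReal.sum_le_tsum _)
  have ham : ∀ i, Measurable (a i) := fun i => by
    have := hd.continuous
    exact (Continuous.enorm (by fun_prop)).measurable
  have hhalf : fockMass α P (fun z => h (((1 / 2 : ℝ) : ℂ) * z)) ≠ ∞ := by
    obtain ⟨A, C, hC, hcoef⟩ := exists_norm_iteratedDeriv_le_fockMass hα hP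
    set N := ((fockMass α P f) ^ (1 / P)).toReal with hN
    have hN0 : 0 ≤ N := ENNReal.toReal_nonneg
    have hb : ∀ k, ‖iteratedDeriv k h 0‖ ≤ C * N * (((k : ℝ) + 1) ^ A * coeffWeight α k) := by
      intro k
      cases k with
      | zero =>
        rw [iteratedDeriv_zero, hh, volterra_apply_zero, norm_zero]
        have := coeffWeight_pos hα 0
        positivity
      | succ k =>
        rw [hh, iteratedDeriv_succ_volterra hf]
        refine (hcoef f hf hI k).trans ?_
        have hw : coeffWeight α k ≤ coeffWeight α (k + 1) := by
          unfold coeffWeight facWeight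
          have := one_le_rpow_inv_self hα
          gcongr
          · omega
          · omega
        have := coeffWeight_pos hα k
        have := coeffWeight_pos hα (k + 1)
        rw [mul_right_comm]
        gcongr
        linarith
    exact fockMass_dilation_ne_top hα hP hd hb (by norm_num) (by norm_num)
  set E : ℂ → ℝ≥0∞ := fun z => ENNReal.ofReal (Real.exp (-P * ‖z‖ ^ α)) with hE
  have hEm : Measurable E := (continuous_exp_neg_norm_rpow hα P).measurable
  have hmass : fockMass α P h ≤ 2 ^ P * (fockMass α P (fun z => h (((1 / 2 : ℝ) : ℂ) * z)) +
      C₂ * ∑' i, (ENNReal.ofReal L) ^ i * (ENNReal.ofReal (C₁ * δ i ^ e) * fockMass α P f)) := by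
    calc fockMass α P h ≤ ∫⁻ z, 2 ^ P * (‖h (((1 / 2 : ℝ) : ℂ) * z)‖ₑ ^ P * E z +
          C₂ * ∑' i, (ENNReal.ofReal L) ^ i * (a i z ^ P * E z)) := by
          refine lintegral_mono fun z => ?_
          have h1 := (ENNReal.rpow_le_rpow (htele z) hP.le).trans
            (ennreal_add_rpow_le hP.le _ _)
          have h2 := hsum fun i => a i z
          calc _ ≤ 2 ^ P * (‖h (((1 / 2 : ℝ) : ℂ) * z)‖ₑ ^ P +
                C₂ * ∑' i, (ENNReal.ofReal L) ^ i * a i z ^ P) * E z := by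
                refine mul_le_mul_left (h1.trans ?_) _
                gcongr
            _ = _ := by
                simp_rw [← mul_assoc, ENNReal.tsum_mul_right]
                ring
      _ = 2 ^ P * (fockMass α P (fun z => h (((1 / 2 : ℝ) : ℂ) * z)) +
          C₂ * ∑' i, (ENNReal.ofReal L) ^ i *
            fockMass α P (fun z => h ((1 - δ i / 2) * z) - h ((1 - δ i) * z))) := by
          rw [lintegral_const_mul' _ _ (ENNReal.rpow_ne_top_of_nonneg hP.le ENNReal.ofNat_ne_top),
            lintegral_add_left, lintegral_const_mul' _ _ hC₂, lintegral_tsum]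
          · simp_rw [lintegral_const_mul' _ _ (ENNReal.pow_ne_top ENNReal.ofReal_ne_top)]
            rfl
          · exact fun i => ((((ham i).pow_const P).mul hEm).const_mul _).aemeasurable
          · have := hd.continuous
            exact ((Continuous.enorm (by fun_prop)).measurable.pow_const P).mul hEm
      _ ≤ _ := by
          gcongr with i
          have := hinc h hd (δ i) (hδ0 i) (hδ1 i)
          rwa [hh, deriv_volterra hf] at this
  have hgeo : Summable fun i : ℕ => L ^ i * (C₁ * δ i ^ e) := by
    have h1 : ∀ i : ℕ, L ^ i * (C₁ * δ i ^ e) = C₁ * (1 / 2) ^ e * ((1 / 2 : ℝ) ^ (e / 2)) ^ i := by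
      intro i
      have h2 : δ i ^ e = (1 / 2) ^ e *
          (((1 / 2 : ℝ) ^ (e / 2)) ^ i * ((1 / 2 : ℝ) ^ (e / 2)) ^ i) := by
        simp only [hδ]
        rw [← mul_pow, ← Real.rpow_add (by norm_num), add_halves, ← Real.rpow_natCast,
          ← Real.rpow_natCast, ← Real.rpow_mul (by norm_num), ← Real.rpow_mul (by norm_num),
          ← Real.rpow_add (by norm_num)]
        congr 1; push_cast; ring
      have h3 : L ^ i * ((1 / 2 : ℝ) ^ (e / 2)) ^ i = 1 := by
        rw [← mul_pow, hL, ← Real.mul_rpow (by norm_num) (by norm_num)]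
        norm_num
      rw [h2]
      calc _ = C₁ * (1 / 2) ^ e * ((1 / 2 : ℝ) ^ (e / 2)) ^ i *
            (L ^ i * ((1 / 2 : ℝ) ^ (e / 2)) ^ i) := by ring
        _ = _ := by rw [h3, mul_one]
    simp_rw [h1]
    refine (summable_geometric_of_lt_one (by positivity) ?_).mul_left _
    exact Real.rpow_lt_one (by norm_num) (by norm_num) (by positivity)
  refine ne_top_of_le_ne_top (ENNReal.mul_ne_top
    (ENNReal.rpow_ne_top_of_nonneg hP.le ENNReal.ofNat_ne_top) (ENNReal.add_ne_top.2 ⟨hhalf,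
      ENNReal.mul_ne_top hC₂ ?_⟩)) hmass
  simp_rw [← mul_assoc]
  rw [ENNReal.tsum_mul_right]
  refine ENNReal.mul_ne_top ?_ hI
  have h1 : ∀ i : ℕ, (ENNReal.ofReal L) ^ i * ENNReal.ofReal (C₁ * δ i ^ e) =
      ENNReal.ofReal (L ^ i * (C₁ * δ i ^ e)) := fun i => by
    rw [ENNReal.ofReal_mul (p := L ^ i) (by positivity), ENNReal.ofReal_pow hL0.le]
  simp_rw [h1]
  exact hgeo.tsum_ofReal_ne_top

end Volterra

/-! ### Dilations converge in norm -/

section Dilation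

variable {α P : ℝ}

theorem lintegral_comp_mul_complex {g : ℂ → ℝ≥0∞} (hg : Measurable g) {r : ℝ} (hr : 0 < r) :
    ∫⁻ z : ℂ, g (r * z) = ENNReal.ofReal (r ^ 2)⁻¹ * ∫⁻ z, g z := by
  have h := Measure.map_addHaar_smul (volume : Measure ℂ) hr.ne'
  rw [Complex.finrank_real_complex, abs_of_pos (by positivity)] at h
  have h1 : ∫⁻ z, g z ∂(Measure.map (fun z : ℂ => r • z) volume) = ∫⁻ z : ℂ, g (r * z) := by
    rw [lintegral_map hg (by fun_prop)]
    simp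
  rw [← h1, h, lintegral_smul_measure, smul_eq_mul]

theorem exists_lintegral_compl_ball_le {g : ℂ → ℝ≥0∞} (hg : Measurable g) (hfin : ∫⁻ z, g z ≠ ∞)
    {η : ℝ≥0∞} (hη : 0 < η) :
    ∃ R : ℝ, 0 < R ∧ ∫⁻ z, (Metric.ball (0 : ℂ) R)ᶜ.indicator g z ≤ η := by
  have h : Filter.Tendsto (fun n : ℕ => ∫⁻ z, (Metric.ball (0 : ℂ) n)ᶜ.indicator g z)
      Filter.atTop (nhds (∫⁻ _ : ℂ, 0)) := by
    refine tendsto_lintegral_of_dominated_convergence g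
      (fun n => hg.indicator measurableSet_ball.compl)
      (fun n => Filter.Eventually.of_forall fun z => Set.indicator_le_self _ _ _) hfin
      (Filter.Eventually.of_forall fun z => ?_)
    obtain ⟨n₀, hn₀⟩ := exists_nat_gt ‖z‖
    refine tendsto_const_nhds.congr' ?_
    filter_upwards [Filter.eventually_ge_atTop n₀] with n hn
    rw [Set.indicator_of_notMem]
    simp only [Set.mem_compl_iff, Metric.mem_ball, dist_zero_right, not_not]
    exact hn₀.trans_le (by exact_mod_cast hn)
  rw [lintegral_zero] at h
  obtain ⟨n, hn, hn'⟩ := ((h.eventually_le_const hη).and (Filter.eventually_gt_atTop 0)).exists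
  exact ⟨n, by exact_mod_cast hn', hn⟩

/-- Dilations `f (r z)`, `r < 1`, approximate `f` in norm: outside a large disc all of them have
small mass, and on the disc the convergence is uniform. -/
theorem exists_fockMass_dilation_sub_le (hα : 1 < α) (hP : 0 < P) {f : ℂ → ℂ}
    (hf : Differentiable ℂ f) (hI : fockMass α P f ≠ ∞) {η : ℝ≥0∞} (hη : 0 < η) :
    ∃ r : ℝ, 0 < r ∧ r < 1 ∧ fockMass α P (fun z => f (r * z) - f z) ≤ η := by
  have hfc := hf.continuous
  set E : ℂ → ℝ≥0∞ := fun z => ENNReal.ofReal (Real.exp (-P * ‖z‖ ^ α)) with hE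
  have hEm : Measurable E := (continuous_exp_neg_norm_rpow hα P).measurable
  have hE1 : ∀ z, E z ≤ 1 := fun z => by
    rw [hE, ENNReal.ofReal_le_one, Real.exp_le_one_iff]
    have : 0 ≤ ‖z‖ ^ α := by positivity
    nlinarith
  set g : ℂ → ℝ≥0∞ := fun z => ‖f z‖ₑ ^ P * E z with hg
  have hgm : Measurable g := (hfc.measurable.enorm.pow_const P).mul hEm
  have h2P : (2 : ℝ≥0∞) ^ P ≠ ∞ := ENNReal.rpow_ne_top_of_nonneg hP.le ENNReal.ofNat_ne_top
  have h2P0 : (2 : ℝ≥0∞) ^ P ≠ 0 := by simp [ENNReal.rpow_eq_zero_iff]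
  -- the tail of `f` counts once for `f` and at most four times for its dilations
  set κ : ℝ≥0∞ := 2 ^ P * 5 with hκ
  have hκ0 : κ ≠ 0 := mul_ne_zero h2P0 (by norm_num)
  have hκt : κ ≠ ∞ := ENNReal.mul_ne_top h2P (by norm_num)
  obtain ⟨R, hR, htail⟩ := exists_lintegral_compl_ball_le hgm hI
    (η := η / 2 / κ) (ENNReal.div_pos (ENNReal.half_pos hη.ne').ne' hκt)
  set B : Set ℂ := Metric.ball 0 (2 * R) with hB
  set T : ℂ → ℝ≥0∞ := (Metric.ball (0 : ℂ) R)ᶜ.indicator g with hT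
  have hTm : Measurable T := hgm.indicator measurableSet_ball.compl
  set r : ℕ → ℝ := fun n => 1 - (1 / 2) ^ (n + 1) with hr
  have hr1 : ∀ n, r n < 1 := fun n => by
    have : (0 : ℝ) < (1 / 2) ^ (n + 1) := by positivity
    simp only [hr]; linarith
  have hr2 : ∀ n, 1 / 2 ≤ r n := fun n => by
    have : (1 / 2 : ℝ) ^ (n + 1) ≤ 1 / 2 := by
      rw [pow_succ]
      exact mul_le_of_le_one_left (by norm_num) (pow_le_one₀ (by norm_num) (by norm_num))
    simp only [hr]; linarith
  have hr0 : ∀ n, 0 < r n := fun n => by linarith [hr2 n]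
  have hrlim : Filter.Tendsto r Filter.atTop (nhds 1) := by
    have h1 : Filter.Tendsto (fun n : ℕ => (1 / 2 : ℝ) ^ (n + 1)) Filter.atTop (nhds 0) :=
      (tendsto_pow_atTop_nhds_zero_of_lt_one (by norm_num) (by norm_num)).comp
        (Filter.tendsto_add_atTop_nat 1)
    simpa [hr] using h1.const_sub 1
  set F : ℕ → ℂ → ℝ≥0∞ := fun n z => ‖f (r n * z) - f z‖ₑ ^ P * E z with hF
  have hFm : ∀ n, Measurable (F n) := fun n => by
    have : Continuous fun z => f (r n * z) - f z := by fun_prop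
    exact (this.measurable.enorm.pow_const P).mul hEm
  have hloc : Filter.Tendsto (fun n => ∫⁻ z in B, F n z) Filter.atTop (nhds (∫⁻ _ in B, 0)) := by
    obtain ⟨M, hM⟩ := (isCompact_closedBall (0 : ℂ) (2 * R)).exists_bound_of_continuousOn
      hfc.continuousOn
    refine tendsto_lintegral_of_dominated_convergence
      (fun _ => ENNReal.ofReal (M + M) ^ P) hFm (fun n => ?_) ?_ ?_
    · refine (ae_restrict_mem measurableSet_ball).mono fun z hz => ?_
      have hz1 : z ∈ Metric.closedBall (0 : ℂ) (2 * R) := Metric.ball_subset_closedBall hz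
      have hz2 : (r n : ℂ) * z ∈ Metric.closedBall (0 : ℂ) (2 * R) := by
        rw [Metric.mem_closedBall, dist_zero_right] at hz1 ⊢
        rw [norm_mul, Complex.norm_real, Real.norm_of_nonneg (hr0 n).le]
        exact (mul_le_of_le_one_left (norm_nonneg _) (hr1 n).le).trans hz1
      calc F n z ≤ ‖f (r n * z) - f z‖ₑ ^ P * 1 := by
            simp only [hF]; gcongr; exact hE1 z
        _ ≤ _ := by
            rw [mul_one, ← ofReal_norm]
            exact ENNReal.rpow_le_rpow (ENNReal.ofReal_le_ofReal
              ((norm_sub_le _ _).trans (add_le_add (hM _ hz2) (hM _ hz1)))) hP.le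
    · rw [lintegral_const, Measure.restrict_apply_univ]
      exact ENNReal.mul_ne_top (ENNReal.rpow_ne_top_of_nonneg hP.le ENNReal.ofReal_ne_top)
        measure_ball_lt_top.ne
    · refine Filter.Eventually.of_forall fun z => ?_
      have h1 : Filter.Tendsto (fun n => f (r n * z) - f z) Filter.atTop (nhds 0) := by
        have h2 : Filter.Tendsto (fun n => (r n : ℂ) * z) Filter.atTop (nhds z) := by
          simpa using ((Complex.continuous_ofReal.tendsto 1).comp hrlim).mul_const z
        simpa using ((hfc.tendsto z).comp h2).sub_const (f z)
      have h3 := (ENNReal.continuous_rpow_const (y := P)).tendsto 0 |>.comp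
        (by simpa using h1.enorm :
          Filter.Tendsto (fun n => ‖f (r n * z) - f z‖ₑ) Filter.atTop (nhds 0))
      rw [ENNReal.zero_rpow_of_pos hP] at h3
      simpa using ENNReal.Tendsto.mul_const (b := E z) h3
        (Or.inr ((hE1 z).trans_lt ENNReal.one_lt_top).ne)
  rw [lintegral_zero] at hloc
  obtain ⟨n, hn⟩ := (hloc.eventually_le_const (ENNReal.half_pos hη.ne')).exists
  refine ⟨r n, hr0 n, hr1 n, ?_⟩
  have hout : ∫⁻ z in Bᶜ, F n z ≤ η / 2 := by
    calc ∫⁻ z in Bᶜ, F n z ≤ ∫⁻ z in Bᶜ, 2 ^ P * (T (r n * z) + T z) := by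
          refine setLIntegral_mono' measurableSet_ball.compl fun z hz => ?_
          rw [hB, Set.mem_compl_iff, Metric.mem_ball, dist_zero_right, not_lt] at hz
          have hnorm : ‖(r n : ℂ) * z‖ = r n * ‖z‖ := by
            rw [norm_mul, Complex.norm_real, Real.norm_of_nonneg (hr0 n).le]
          have hz1 : z ∈ (Metric.ball (0 : ℂ) R)ᶜ := by
            rw [Set.mem_compl_iff, Metric.mem_ball, dist_zero_right, not_lt]; linarith
          have hz2 : (r n : ℂ) * z ∈ (Metric.ball (0 : ℂ) R)ᶜ := by
            rw [Set.mem_compl_iff, Metric.mem_ball, dist_zero_right, not_lt, hnorm]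
            nlinarith [hr2 n]
          rw [hT, Set.indicator_of_mem hz1, Set.indicator_of_mem hz2]
          have hEr : E z ≤ E (r n * z) := by
            refine ENNReal.ofReal_le_ofReal (Real.exp_le_exp.2 ?_)
            rw [hnorm]
            have h1 : (r n * ‖z‖) ^ α ≤ ‖z‖ ^ α := by
              have := hr0 n
              exact Real.rpow_le_rpow (by positivity)
                (mul_le_of_le_one_left (norm_nonneg _) (hr1 n).le) (by linarith)
            nlinarith
          calc F n z ≤ 2 ^ P * (‖f (r n * z)‖ₑ ^ P + ‖f z‖ₑ ^ P) * E z := by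
                simp only [hF]
                gcongr
                exact (ENNReal.rpow_le_rpow (enorm_sub_le) hP.le).trans
                  (ennreal_add_rpow_le hP.le _ _)
            _ = 2 ^ P * (‖f (r n * z)‖ₑ ^ P * E z + ‖f z‖ₑ ^ P * E z) := by ring
            _ ≤ _ := by simp only [hg]; gcongr
      _ ≤ ∫⁻ z, 2 ^ P * (T (r n * z) + T z) := setLIntegral_le_lintegral _ _
      _ = 2 ^ P * (ENNReal.ofReal (r n ^ 2)⁻¹ * (∫⁻ z, T z) + ∫⁻ z, T z) := by
          rw [lintegral_const_mul' _ _ h2P, lintegral_add_right _ hTm,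
            lintegral_comp_mul_complex hTm (hr0 n)]
      _ ≤ 2 ^ P * (4 * (η / 2 / κ) + η / 2 / κ) := by
          gcongr
          rw [show (4 : ℝ≥0∞) = ENNReal.ofReal 4 by norm_num]
          refine ENNReal.ofReal_le_ofReal ?_
          have := hr0 n
          rw [inv_le_iff_one_le_mul₀ (by positivity)]
          nlinarith [hr2 n]
      _ = κ * (η / 2 / κ) := by rw [hκ]; ring
      _ = η / 2 := ENNReal.mul_div_cancel hκ0 hκt
  calc fockMass α P (fun z => f (r n * z) - f z) = (∫⁻ z in B, F n z) + ∫⁻ z in Bᶜ, F n z :=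
        (lintegral_add_compl _ measurableSet_ball).symm
    _ ≤ η / 2 + η / 2 := add_le_add hn hout
    _ = η := ENNReal.add_halves η

end Dilation

/-! ### The space, its topology and its Taylor coefficients -/

namespace FockSpace

variable {φ : ℝ → ℝ} {p : ℝ≥0∞}

theorem differentiable_toFun (f : FockSpace φ p) : Differentiable ℂ f.toFun := f.2.1

theorem contDiff_toFun (f : FockSpace φ p) {n : WithTop ℕ∞} : ContDiff ℂ n f.toFun :=
  f.differentiable_toFun.contDiff

theorem toFun_injective : Function.Injective (toFun : FockSpace φ p → ℂ → ℂ) :=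
  Subtype.val_injective

theorem toFun_add (f g : FockSpace φ p) : (f + g).toFun = f.toFun + g.toFun := rfl

theorem toFun_sub (f g : FockSpace φ p) : (f - g).toFun = f.toFun - g.toFun := rfl

theorem toFun_smul (c : ℂ) (f : FockSpace φ p) : (c • f).toFun = c • f.toFun := rfl

/-- The Taylor coefficients `f^{(k)}(0)`, as the coefficients of a power series. With this
normalisation the Volterra operator becomes multiplication by the variable. -/
noncomputable def taylor : FockSpace φ p →ₗ[ℂ] PowerSeries ℂ where
  toFun f := PowerSeries.mk fun k => iteratedDeriv k f.toFun 0
  map_add' f g := by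
    ext k
    simp only [PowerSeries.coeff_mk, map_add, toFun_add]
    exact iteratedDeriv_add f.contDiff_toFun.contDiffAt g.contDiff_toFun.contDiffAt
  map_smul' c f := by
    ext k
    simp only [PowerSeries.coeff_mk, map_smul, toFun_smul, RingHom.id_apply]
    exact iteratedDeriv_const_smul f.contDiff_toFun.contDiffAt c

theorem coeff_taylor (f : FockSpace φ p) (k : ℕ) :
    PowerSeries.coeff k (taylor f) = iteratedDeriv k f.toFun 0 := by
  simp [taylor]

theorem taylor_injective : Function.Injective (taylor : FockSpace φ p → PowerSeries ℂ) := by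
  intro f g h
  refine toFun_injective (funext fun z => ?_)
  have hf := Complex.hasSum_taylorSeries_of_entire f.differentiable_toFun 0 z
  have hg := Complex.hasSum_taylorSeries_of_entire g.differentiable_toFun 0 z
  simp_rw [← coeff_taylor] at hf hg
  rw [h] at hf
  exact hf.unique hg

theorem mem_vanishingAtZero {N : ℕ} {f : FockSpace φ p} :
    f ∈ vanishingAtZero φ p N ↔ PowerSeries.X ^ N ∣ taylor f := by
  rw [PowerSeries.X_pow_dvd_iff]
  simp only [coeff_taylor]
  rfl

theorem mem_closure_of_fockNorm_sub_lt {S : Set (FockSpace φ p)} {f : FockSpace φ p}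
    (h : ∀ ε : ℝ≥0∞, 0 < ε → ∃ g ∈ S, fockNorm φ p (g - f).toFun < ε) : f ∈ closure S := by
  rw [mem_closure_iff]
  intro U hU hfU
  obtain ⟨ε, hε, hball⟩ := hU f hfU
  obtain ⟨g, hgS, hg⟩ := h ε hε
  exact ⟨g, hball g hg, hgS⟩

/-- The weighted `ℓ¹` norm on power series which, for suitable `Q`, dominates the norm. -/
noncomputable def coeffNorm (α : ℝ) (Q : ℕ) (b : PowerSeries ℂ) : ℝ≥0∞ :=
  ∑' m, ‖PowerSeries.coeff m b‖ₑ * ENNReal.ofReal (((m : ℝ) + 1) ^ Q / coeffWeight α m)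

section PowerWeight

variable {α : ℝ}

theorem fockNorm_eq_fockMass (hp0 : p ≠ 0) (hp : p ≠ ∞) (hφ : ∀ r : ℝ, 0 ≤ r → φ r = r ^ α)
    (f : ℂ → ℂ) : fockNorm φ p f = fockMass α p.toReal f ^ (1 / p.toReal) := by
  rw [fockNorm_eq_lintegral φ hp0 hp]
  unfold fockMass
  simp_rw [hφ _ (norm_nonneg _)]

theorem fockMass_ne_top (hp0 : p ≠ 0) (hp : p ≠ ∞) (hφ : ∀ r : ℝ, 0 ≤ r → φ r = r ^ α)
    (f : FockSpace φ p) : fockMass α p.toReal f.toFun ≠ ∞ := by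
  have h : fockNorm φ p f.toFun ≠ ∞ := f.2.2.2.ne
  rw [fockNorm_eq_fockMass hp0 hp hφ] at h
  intro h'
  have := ENNReal.toReal_pos hp0 hp
  rw [h', ENNReal.top_rpow_of_pos (by positivity)] at h
  exact h rfl

theorem exists_toFun_eq (hα : 1 < α) (hp0 : p ≠ 0) (hp : p ≠ ∞)
    (hφ : ∀ r : ℝ, 0 ≤ r → φ r = r ^ α) {h : ℂ → ℂ} (hh : Differentiable ℂ h)
    (hfin : fockMass α p.toReal h ≠ ∞) : ∃ f : FockSpace φ p, f.toFun = h := by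
  refine ⟨⟨h, hh, ?_, ?_⟩, rfl⟩
  · simp_rw [hφ _ (norm_nonneg _)]
    have h1 : Continuous fun z : ℂ => ‖z‖ ^ α :=
      continuous_norm.rpow_const fun _ => Or.inr (by linarith)
    have := hh.continuous
    exact Continuous.aestronglyMeasurable (by fun_prop)
  · have h1 : fockNorm φ p h ≠ ∞ := by
      rw [fockNorm_eq_fockMass hp0 hp hφ]
      exact ENNReal.rpow_ne_top_of_nonneg (by positivity) hfin
    exact h1.lt_top

theorem exists_toFun_eq_volterra (hα : 1 < α) (hp0 : p ≠ 0) (hp : p ≠ ∞)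
    (hφ : ∀ r : ℝ, 0 ≤ r → φ r = r ^ α) (f : FockSpace φ p) :
    ∃ g : FockSpace φ p, g.toFun = volterra f.toFun :=
  exists_toFun_eq hα hp0 hp hφ (differentiable_volterra f.differentiable_toFun)
    (fockMass_volterra_ne_top hα (ENNReal.toReal_pos hp0 hp) f.differentiable_toFun
      (fockMass_ne_top hp0 hp hφ f))

theorem taylor_of_toFun_eq_volterra {f g : FockSpace φ p} (h : g.toFun = volterra f.toFun) :
    taylor g = PowerSeries.X * taylor f := by
  ext k
  rw [coeff_taylor, h]
  cases k with
  | zero => simp [volterra_apply_zero]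
  | succ k =>
    rw [PowerSeries.coeff_succ_X_mul, iteratedDeriv_succ_volterra f.differentiable_toFun,
      coeff_taylor]

theorem exists_fockNorm_le_coeffNorm (hα : 1 < α) (hp0 : p ≠ 0) (hp : p ≠ ∞)
    (hφ : ∀ r : ℝ, 0 ≤ r → φ r = r ^ α) :
    ∃ (Q : ℕ) (C : ℝ≥0∞), C ≠ ∞ ∧ ∀ f : FockSpace φ p,
      fockNorm φ p f.toFun ≤ C * coeffNorm α Q (taylor f) := by
  obtain ⟨Q, C, hC, h⟩ := exists_fockMass_le_tsum hα (ENNReal.toReal_pos hp0 hp)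
  refine ⟨Q, C, hC, fun f => ?_⟩
  rw [fockNorm_eq_fockMass hp0 hp hφ]
  simpa only [coeffNorm, coeff_taylor] using h f.toFun f.differentiable_toFun

theorem exists_norm_coeff_taylor_le (hα : 1 < α) (hp0 : p ≠ 0) (hp : p ≠ ∞)
    (hφ : ∀ r : ℝ, 0 ≤ r → φ r = r ^ α) :
    ∃ (A : ℕ) (C : ℝ), 0 < C ∧ ∀ (f : FockSpace φ p) (k : ℕ),
      ‖PowerSeries.coeff k (taylor f)‖ ≤
        C * (((k : ℝ) + 1) ^ A * coeffWeight α k) * (fockNorm φ p f.toFun).toReal := by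
  obtain ⟨A, C, hC, h⟩ := exists_norm_iteratedDeriv_le_fockMass hα (ENNReal.toReal_pos hp0 hp)
  refine ⟨A, C, hC, fun f k => ?_⟩
  rw [fockNorm_eq_fockMass hp0 hp hφ, coeff_taylor]
  exact h f.toFun f.differentiable_toFun (fockMass_ne_top hp0 hp hφ f) k

/-- The vanishing subspaces are closed since Taylor coefficients are continuous. -/
theorem isClosed_vanishingAtZero (hα : 1 < α) (hp0 : p ≠ 0) (hp : p ≠ ∞)
    (hφ : ∀ r : ℝ, 0 ≤ r → φ r = r ^ α) (N : ℕ) : IsClosed (vanishingAtZero φ p N) := by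
  obtain ⟨A, C, hC, hcoef⟩ := exists_norm_coeff_taylor_le hα hp0 hp hφ
  refine ⟨fun f hf => ?_⟩
  rw [Set.mem_compl_iff, mem_vanishingAtZero, PowerSeries.X_pow_dvd_iff] at hf
  push Not at hf
  obtain ⟨k, hk, hfk⟩ := hf
  set W : ℝ := C * (((k : ℝ) + 1) ^ A * coeffWeight α k) with hW
  have hW0 : 0 < W := by have := coeffWeight_pos hα k; positivity
  have hn : 0 < ‖PowerSeries.coeff k (taylor f)‖ := norm_pos_iff.2 hfk
  refine ⟨ENNReal.ofReal (‖PowerSeries.coeff k (taylor f)‖ / W), by simpa using by positivity,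
    fun g hg hgN => ?_⟩
  rw [mem_vanishingAtZero, PowerSeries.X_pow_dvd_iff] at hgN
  have h1 := hcoef (g - f) k
  rw [map_sub, map_sub, hgN k hk, zero_sub, norm_neg, ← hW] at h1
  have h2 := ENNReal.toReal_lt_of_lt_ofReal hg
  rw [lt_div_iff₀ hW0] at h2
  linarith

/-! ### Density of polynomials -/

theorem taylor_of_toFun_eq_pow {f : FockSpace φ p} {L : ℕ} (h : f.toFun = fun z : ℂ => z ^ L) :
    taylor f = (L.factorial : ℂ) • PowerSeries.X ^ L := by
  ext k
  rw [coeff_taylor, h, iteratedDeriv_pow, map_smul, PowerSeries.coeff_X_pow, smul_eq_mul]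
  rcases lt_trichotomy k L with hk | rfl | hk
  · rw [if_neg hk.ne, zero_pow (by omega)]; simp
  · simp [Nat.descFactorial_self]
  · rw [if_neg hk.ne', Nat.descFactorial_eq_zero_iff_lt.2 hk]; simp

theorem exists_toFun_eq_pow (hα : 1 < α) (hp0 : p ≠ 0) (hp : p ≠ ∞)
    (hφ : ∀ r : ℝ, 0 ≤ r → φ r = r ^ α) (L : ℕ) :
    ∃ f : FockSpace φ p, f.toFun = fun z : ℂ => z ^ L := by
  obtain ⟨Q, C, hC, h⟩ := exists_fockMass_le_tsum hα (ENNReal.toReal_pos hp0 hp)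
  have hd : Differentiable ℂ fun z : ℂ => z ^ L := by fun_prop
  refine exists_toFun_eq hα hp0 hp hφ hd fun htop => ?_
  have h1 := h _ hd
  have := ENNReal.toReal_pos hp0 hp
  rw [htop, ENNReal.top_rpow_of_pos (by positivity), tsum_eq_single L] at h1
  · exact ENNReal.mul_ne_top hC (ENNReal.mul_ne_top enorm_ne_top ENNReal.ofReal_ne_top)
      (top_le_iff.1 h1)
  · intro k hk
    rw [iteratedDeriv_pow]
    rcases lt_or_gt_of_ne hk with hk | hk
    · rw [zero_pow (by omega)]; simp
    · rw [Nat.descFactorial_eq_zero_iff_lt.2 hk]; simp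

theorem exists_taylor_eq_X_pow (hα : 1 < α) (hp0 : p ≠ 0) (hp : p ≠ ∞)
    (hφ : ∀ r : ℝ, 0 ≤ r → φ r = r ^ α) (L : ℕ) :
    ∃ e : FockSpace φ p, taylor e = PowerSeries.X ^ L ∧
      ((L.factorial : ℂ) • e).toFun = fun z : ℂ => z ^ L := by
  obtain ⟨f, hf⟩ := exists_toFun_eq_pow hα hp0 hp hφ L
  have hL : (L.factorial : ℂ) ≠ 0 := by exact_mod_cast L.factorial_ne_zero
  refine ⟨(L.factorial : ℂ)⁻¹ • f, ?_, ?_⟩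
  · rw [map_smul, taylor_of_toFun_eq_pow hf, smul_smul, inv_mul_cancel₀ hL, one_smul]
  · rwa [smul_smul, mul_inv_cancel₀ hL, one_smul]

theorem tendsto_tsum_tail {t : ℕ → ℝ≥0∞} (ht : ∑' m, t m ≠ ∞) :
    Filter.Tendsto (fun n => ∑' m, if m < n then 0 else t m) Filter.atTop (nhds 0) := by
  refine (ENNReal.tendsto_sum_nat_add t ht).congr fun n => ?_
  have h := Summable.sum_add_tsum_nat_add'
    (ENNReal.summable (f := fun m => if m + n < n then 0 else t (m + n)))
    (f := fun m => if m < n then 0 else t m) (k := n)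
  rw [← h, Finset.sum_eq_zero, zero_add]
  · exact tsum_congr fun m => by rw [if_neg (by omega)]
  · intro m hm
    rw [if_pos (Finset.mem_range.1 hm)]

/-- If `f - g n` has coefficients bounded by the tails of a convergent series, then `f` is a limit
of the `g n`. -/
theorem mem_closure_of_coeff_le_tail {Q : ℕ} {C : ℝ≥0∞} (hC : C ≠ ∞)
    (hbound : ∀ f : FockSpace φ p, fockNorm φ p f.toFun ≤ C * coeffNorm α Q (taylor f))
    {S : Set (FockSpace φ p)} {f : FockSpace φ p} {t : ℕ → ℝ≥0∞} (ht : ∑' m, t m ≠ ∞)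
    (g : ℕ → FockSpace φ p) (hg : ∀ n, g n ∈ S)
    (hle : ∀ n m, ‖PowerSeries.coeff m (taylor (g n - f))‖ₑ *
      ENNReal.ofReal (((m : ℝ) + 1) ^ Q / coeffWeight α m) ≤ if m < n then 0 else t m) :
    f ∈ closure S := by
  refine mem_closure_of_fockNorm_sub_lt fun ε hε => ?_
  have h : Filter.Tendsto (fun n => C * ∑' m, if m < n then 0 else t m) Filter.atTop (nhds 0) := by
    simpa using ENNReal.Tendsto.const_mul (tendsto_tsum_tail ht) (Or.inr hC)
  obtain ⟨n, hn⟩ := (h.eventually_lt_const hε).exists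
  refine ⟨g n, hg n, (hbound _).trans_lt (lt_of_le_of_lt ?_ hn)⟩
  unfold coeffNorm
  gcongr with m
  exact hle n m

theorem mem_closure_span_of_coeffNorm_ne_top (hα : 1 < α) (hp0 : p ≠ 0) (hp : p ≠ ∞)
    (hφ : ∀ r : ℝ, 0 ≤ r → φ r = r ^ α) {Q : ℕ} {C : ℝ≥0∞} (hC : C ≠ ∞)
    (hbound : ∀ f : FockSpace φ p, fockNorm φ p f.toFun ≤ C * coeffNorm α Q (taylor f))
    {N : ℕ} {f : FockSpace φ p} (hfN : f ∈ vanishingAtZero φ p N)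
    (hf : coeffNorm α Q (taylor f) ≠ ∞) :
    f ∈ closure (Submodule.span ℂ (monomialsFrom φ p N) : Set (FockSpace φ p)) := by
  choose e he hmon using exists_taylor_eq_X_pow (φ := φ) hα hp0 hp hφ
  rw [mem_vanishingAtZero, PowerSeries.X_pow_dvd_iff] at hfN
  set a : ℕ → ℂ := fun k => PowerSeries.coeff k (taylor f) with ha
  refine mem_closure_of_coeff_le_tail hC hbound hf (fun n => ∑ k ∈ Finset.range n, a k • e k)
    (fun n => ?_) (fun n m => ?_)
  · refine Submodule.sum_mem _ fun k _ => ?_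
    rcases lt_or_ge k N with hk | hk
    · rw [ha]; simp only; rw [hfN k hk, zero_smul]; exact Submodule.zero_mem _
    · have hL : (k.factorial : ℂ) ≠ 0 := by exact_mod_cast k.factorial_ne_zero
      have h1 : a k • e k = (a k * (k.factorial : ℂ)⁻¹) • ((k.factorial : ℂ) • e k) := by
        rw [smul_smul, mul_assoc, inv_mul_cancel₀ hL, mul_one]
      rw [h1]
      exact Submodule.smul_mem _ _ (Submodule.subset_span ⟨k, hk, hmon k⟩)
  · have h1 : PowerSeries.coeff m (taylor (∑ k ∈ Finset.range n, a k • e k - f)) =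
        if m < n then 0 else -a m := by
      rw [map_sub, map_sum, map_sub, map_sum]
      simp only [map_smul, he, PowerSeries.coeff_X_pow, smul_eq_mul, mul_ite, mul_one, mul_zero,
        Finset.sum_ite_eq, Finset.mem_range]
      split_ifs <;> simp [ha]
    rw [h1]
    split_ifs
    · simp
    · rw [enorm_neg]

/-- Functions vanishing to order `N` at `0` are limits of combinations of `z ^ k`, `k ≥ N`: the
Taylor sums of a dilation `f (r z)` converge to it in norm, and the dilations converge to `f`. -/
theorem vanishingAtZero_eq_closure_span (hα : 1 < α) (hp0 : p ≠ 0) (hp : p ≠ ∞)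
    (hφ : ∀ r : ℝ, 0 ≤ r → φ r = r ^ α) (N : ℕ) : vanishingAtZero φ p N =
      closure (Submodule.span ℂ (monomialsFrom φ p N) : Set (FockSpace φ p)) := by
  have hP := ENNReal.toReal_pos hp0 hp
  apply subset_antisymm
  · intro f hf
    obtain ⟨Q, C, hC, hbound⟩ := exists_fockNorm_le_coeffNorm (φ := φ) hα hp0 hp hφ
    obtain ⟨A, K, hK, hcoef⟩ := exists_norm_coeff_taylor_le (φ := φ) hα hp0 hp hφ
    have hb : ∀ k, ‖iteratedDeriv k f.toFun 0‖ ≤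
        K * (fockNorm φ p f.toFun).toReal * (((k : ℝ) + 1) ^ A * coeffWeight α k) := fun k => by
      rw [← coeff_taylor, mul_right_comm]; exact hcoef f k
    rw [← closure_closure]
    refine mem_closure_of_fockNorm_sub_lt fun ε hε => ?_
    obtain ⟨η, hη, hηε⟩ := exists_between (ENNReal.rpow_pos_of_nonneg hε hP.le)
    obtain ⟨r, hr0, hr1, hr⟩ := exists_fockMass_dilation_sub_le hα hP f.differentiable_toFun
      (fockMass_ne_top hp0 hp hφ f) hη
    obtain ⟨g, hg⟩ := exists_toFun_eq hα hp0 hp hφ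
      (f.differentiable_toFun.comp (differentiable_id.const_mul (r : ℂ)))
      (fockMass_dilation_ne_top hα hP f.differentiable_toFun hb hr0 hr1)
    have hg' : g.toFun = fun z => f.toFun (r * z) := hg
    refine ⟨g, ?_, ?_⟩
    · refine mem_closure_span_of_coeffNorm_ne_top hα hp0 hp hφ hC hbound (fun k hk => ?_) ?_
      · rw [hg', iteratedDeriv_dilation f.differentiable_toFun, hf k hk, mul_zero]
      · unfold coeffNorm
        simp only [coeff_taylor, hg']
        exact tsum_enorm_iteratedDeriv_dilation_ne_top hα f.differentiable_toFun hb hr0 hr1 Q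
    · rw [fockNorm_eq_fockMass hp0 hp hφ, toFun_sub, hg']
      have h1 := ENNReal.rpow_lt_rpow (hr.trans_lt hηε) (z := 1 / p.toReal) (by positivity)
      rwa [← ENNReal.rpow_mul, mul_one_div_cancel hP.ne', ENNReal.rpow_one] at h1
  · refine closure_minimal (fun f hf => ?_) (isClosed_vanishingAtZero hα hp0 hp hφ N)
    rw [mem_vanishingAtZero]
    induction hf using Submodule.span_induction with
    | mem f hf =>
      obtain ⟨k, hk, hfk⟩ := hf
      rw [taylor_of_toFun_eq_pow hfk, PowerSeries.smul_eq_C_mul]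
      exact (pow_dvd_pow _ hk).mul_left _
    | zero => simp
    | add f g _ _ hf hg => rw [map_add]; exact dvd_add hf hg
    | smul c f _ hf => rw [map_smul, PowerSeries.smul_eq_C_mul]; exact hf.mul_left _

end PowerWeight

end FockSpace

/-! ### Shifts gain powers of the index -/

section Shift

variable {β D : ℝ}

theorem facWeight_add_le (hβ : 0 < β) (hβ1 : β ≤ 1) (hD : 1 ≤ D) (k N : ℕ) :
    facWeight β D (k + N) ≤
      (((N : ℝ) + 1) * ((k : ℝ) + 1)) ^ N * D ^ N * facWeight β D k := by
  have hfac : (0 : ℝ) < k.factorial := by exact_mod_cast k.factorial_pos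
  have hX : 1 ≤ (((N : ℝ) + 1) * ((k : ℝ) + 1)) ^ N :=
    one_le_pow₀ (one_le_mul_of_one_le_of_one_le (by simp) (by simp))
  have h1 : ((k + N).factorial : ℝ) ^ β ≤
      (((N : ℝ) + 1) * ((k : ℝ) + 1)) ^ N * (k.factorial : ℝ) ^ β := by
    calc _ ≤ ((((N : ℝ) + 1) * ((k : ℝ) + 1)) ^ N * k.factorial) ^ β :=
          Real.rpow_le_rpow (by positivity) (factorial_add_le k N) hβ.le
      _ = ((((N : ℝ) + 1) * ((k : ℝ) + 1)) ^ N) ^ β * (k.factorial : ℝ) ^ β :=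
          Real.mul_rpow (by positivity) hfac.le
      _ ≤ _ := by
          gcongr
          calc _ ≤ ((((N : ℝ) + 1) * ((k : ℝ) + 1)) ^ N) ^ (1 : ℝ) :=
                Real.rpow_le_rpow_of_exponent_le hX hβ1
            _ = _ := Real.rpow_one _
  unfold facWeight
  calc _ ≤ (((N : ℝ) + 1) * ((k : ℝ) + 1)) ^ N * (k.factorial : ℝ) ^ β * D ^ (k + N) := by gcongr
    _ = _ := by rw [pow_add]; ring

theorem pow_mul_facWeight_le (hβ : 0 < β) (hD : 1 ≤ D) {S L : ℕ} (hL : (S : ℝ) ≤ β * L) (m : ℕ) :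
    ((m : ℝ) + 1) ^ S * facWeight β D m ≤ facWeight β D (m + L) := by
  have hm : (1 : ℝ) ≤ (m : ℝ) + 1 := by simp
  have h1 : (m.factorial : ℝ) * ((m : ℝ) + 1) ^ L ≤ ((m + L).factorial : ℝ) := by
    exact_mod_cast Nat.factorial_mul_pow_le_factorial (m := m) (n := L)
  have h2 : ((m : ℝ) + 1) ^ S * (m.factorial : ℝ) ^ β ≤ ((m + L).factorial : ℝ) ^ β := by
    calc _ ≤ (((m : ℝ) + 1) ^ L) ^ β * (m.factorial : ℝ) ^ β := by
          gcongr
          rw [← Real.rpow_natCast, ← Real.rpow_natCast, ← Real.rpow_mul (by positivity)]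
          exact Real.rpow_le_rpow_of_exponent_le hm (by linarith)
      _ = ((m.factorial : ℝ) * ((m : ℝ) + 1) ^ L) ^ β := by
          rw [Real.mul_rpow (by positivity) (by positivity), mul_comm]
      _ ≤ _ := Real.rpow_le_rpow (by positivity) h1 hβ.le
  unfold facWeight
  rw [← mul_assoc]
  have : D ^ m ≤ D ^ (m + L) := pow_le_pow_right₀ hD (Nat.le_add_right _ _)
  gcongr

/-- After division by the weight shifted by `L`, with `L` large, the growth `polyWeight` becomes
summable. -/
theorem polyWeight_mul_div_facWeight_le (hβ : 0 < β) (hD : 1 ≤ D) {A Q L : ℕ}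
    (hL : ((A + Q + 2 : ℕ) : ℝ) ≤ β * L) (m : ℕ) :
    polyWeight β D A m * ((((m + L : ℕ) : ℝ) + 1) ^ Q / facWeight β D (m + L)) ≤
      ((L : ℝ) + 1) ^ (A + Q + 2) / (((m + L : ℕ) : ℝ) + 1) ^ 2 := by
  have h1 := pow_mul_facWeight_le hβ hD hL m
  have hf := facWeight_pos (β := β) hD m
  have hf' := facWeight_pos (β := β) hD (m + L)
  set x : ℝ := ((m + L : ℕ) : ℝ) + 1 with hx
  have hx0 : 0 < x := by positivity
  have hxm : x ≤ ((L : ℝ) + 1) * ((m : ℝ) + 1) := by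
    rw [hx]; push_cast
    nlinarith [mul_nonneg (Nat.cast_nonneg (α := ℝ) L) (Nat.cast_nonneg (α := ℝ) m)]
  have hmx : (m : ℝ) + 1 ≤ x := by rw [hx]; push_cast; linarith [Nat.cast_nonneg (α := ℝ) L]
  unfold polyWeight
  rw [← mul_div_assoc, div_le_div_iff₀ hf' (by positivity)]
  calc ((m : ℝ) + 1) ^ A * facWeight β D m * x ^ Q * x ^ 2
      ≤ x ^ A * facWeight β D m * x ^ Q * x ^ 2 := by gcongr
    _ = x ^ (A + Q + 2) * facWeight β D m := by ring
    _ ≤ (((L : ℝ) + 1) * ((m : ℝ) + 1)) ^ (A + Q + 2) * facWeight β D m := by gcongr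
    _ = ((L : ℝ) + 1) ^ (A + Q + 2) * (((m : ℝ) + 1) ^ (A + Q + 2) * facWeight β D m) := by
        rw [mul_pow]; ring
    _ ≤ _ := by gcongr

end Shift

/-! ### Invariant subspaces -/

namespace FockSpace

variable {φ : ℝ → ℝ} {p : ℝ≥0∞} {α : ℝ}

theorem exists_mem_taylor_eq_X_pow_mul {M : Submodule ℂ (FockSpace φ p)}
    (hM : IsVolterraInvariant M) {f : FockSpace φ p} (hf : f ∈ M) (j : ℕ) :
    ∃ g ∈ M, taylor g = PowerSeries.X ^ j * taylor f := by
  induction j with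
  | zero => exact ⟨f, hf, by simp⟩
  | succ j ih =>
    obtain ⟨g, hg, hgt⟩ := ih
    obtain ⟨h, hh, hhg⟩ := hM g hg
    exact ⟨h, hh, by rw [taylor_of_toFun_eq_volterra hhg, hgt, pow_succ']; ring⟩

/-- An invariant subspace is stable under polynomials in the Volterra operator. -/
theorem exists_mem_taylor_eq_polynomial_mul {M : Submodule ℂ (FockSpace φ p)}
    (hM : IsVolterraInvariant M) {f : FockSpace φ p} (hf : f ∈ M) (q : Polynomial ℂ) :
    ∃ g ∈ M, taylor g = (q : PowerSeries ℂ) * taylor f := by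
  induction q using Polynomial.induction_on' with
  | add q₁ q₂ h₁ h₂ =>
    obtain ⟨g₁, hg₁, ht₁⟩ := h₁
    obtain ⟨g₂, hg₂, ht₂⟩ := h₂
    exact ⟨g₁ + g₂, M.add_mem hg₁ hg₂, by rw [map_add, ht₁, ht₂, Polynomial.coe_add, add_mul]⟩
  | monomial n a =>
    obtain ⟨g, hg, ht⟩ := exists_mem_taylor_eq_X_pow_mul hM hf n
    refine ⟨a • g, M.smul_mem a hg, ?_⟩
    rw [map_smul, ht, Polynomial.coe_monomial, PowerSeries.smul_eq_C_mul,
      PowerSeries.monomial_eq_C_mul_X_pow, mul_assoc]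

/-- If `V` is the Volterra operator and `f` in a closed invariant subspace has order `N` at `0`,
then some `z ^ L` is in the subspace: with `taylor f = X ^ N * b`, the functions
`P_n(V) V ^ K f`, where `P_n` is the truncated power series of `b⁻¹`, converge to a multiple of
`z ^ (N + K)` if `K` is large enough to compensate all polynomial losses. -/
theorem exists_X_pow_mem (hα : 1 < α) (hp0 : p ≠ 0) (hp : p ≠ ∞)
    (hφ : ∀ r : ℝ, 0 ≤ r → φ r = r ^ α) {M : Submodule ℂ (FockSpace φ p)}
    (hMc : IsClosed (M : Set (FockSpace φ p))) (hM : IsVolterraInvariant M)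
    {f : FockSpace φ p} (hf : f ∈ M) {N : ℕ} {b : PowerSeries ℂ}
    (hb : taylor f = PowerSeries.X ^ N * b) (hb0 : PowerSeries.constantCoeff b ≠ 0) :
    ∃ L, N ≤ L ∧ ∃ e ∈ M, taylor e = PowerSeries.X ^ L := by
  obtain ⟨Q, C, hC, hbound⟩ := exists_fockNorm_le_coeffNorm (φ := φ) hα hp0 hp hφ
  obtain ⟨A, K, hK, hcoef⟩ := exists_norm_coeff_taylor_le (φ := φ) hα hp0 hp hφ
  have hα0 : 0 < α := by linarith
  set β : ℝ := 1 - 1 / α with hβdef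
  set D : ℝ := α ^ (1 / α) with hDdef
  have hβ : 0 < β := by
    have := (div_lt_one hα0).2 hα
    rw [hβdef]; linarith
  have hβ1 : β ≤ 1 := by
    have : 0 < 1 / α := by positivity
    rw [hβdef]; linarith
  have hD : 1 ≤ D := one_le_rpow_inv_self hα
  set F : ℝ := (fockNorm φ p f.toFun).toReal with hF
  have hF0 : 0 ≤ F := ENNReal.toReal_nonneg
  have hbw : ∀ k, ‖PowerSeries.coeff k b‖ ≤
      K * F * ((N : ℝ) + 1) ^ (A + N) * D ^ N * polyWeight β D (A + N) k := by
    intro k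
    have h1 := hcoef f (k + N)
    rw [hb, PowerSeries.coeff_X_pow_mul] at h1
    refine h1.trans ?_
    have h2 : ((k + N : ℕ) : ℝ) + 1 ≤ ((N : ℝ) + 1) * ((k : ℝ) + 1) := by
      push_cast
      nlinarith [mul_nonneg (Nat.cast_nonneg (α := ℝ) k) (Nat.cast_nonneg (α := ℝ) N)]
    have h3 := facWeight_add_le hβ hβ1 hD k N
    have hw := facWeight_pos (β := β) hD (k + N)
    calc _ = K * (((k + N : ℕ) : ℝ) + 1) ^ A * facWeight β D (k + N) * F := by
          unfold coeffWeight; ring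
      _ ≤ K * (((N : ℝ) + 1) * ((k : ℝ) + 1)) ^ A *
          ((((N : ℝ) + 1) * ((k : ℝ) + 1)) ^ N * D ^ N * facWeight β D k) * F := by gcongr
      _ = _ := by
          unfold polyWeight
          rw [mul_pow, mul_pow]; ring
  obtain ⟨C', hC', htrunc⟩ :=
    exists_norm_coeff_trunc_inv_mul_sub_one_le hβ hβ1 hD (A + N) b hb0 hbw
  -- `L` makes the shifted error terms summable
  obtain ⟨K₀, hK₀⟩ := exists_nat_ge (((A + N + Q + 2 : ℕ) : ℝ) / β)
  set L : ℕ := N + K₀ with hL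
  have hLβ : ((A + N + Q + 2 : ℕ) : ℝ) ≤ β * L := by
    rw [div_le_iff₀ hβ] at hK₀
    have : (K₀ : ℝ) ≤ L := by rw [hL]; push_cast; linarith [Nat.cast_nonneg (α := ℝ) N]
    nlinarith
  obtain ⟨e, he, -⟩ := exists_taylor_eq_X_pow (φ := φ) hα hp0 hp hφ L
  refine ⟨L, by omega, e, ?_, he⟩
  choose g hgM hgt using fun n : ℕ => exists_mem_taylor_eq_polynomial_mul hM hf
    (PowerSeries.trunc (n + 1) b⁻¹ * Polynomial.X ^ K₀)
  set t : ℕ → ℝ≥0∞ := fun i =>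
    ENNReal.ofReal (C' * ((L : ℝ) + 1) ^ (A + N + Q + 2) * (1 / ((i : ℝ) + 1) ^ 2)) with ht
  have htfin : ∑' i, t i ≠ ∞ := by
    refine Summable.tsum_ofReal_ne_top (Summable.mul_left _ ?_)
    have h := (summable_nat_add_iff 1).2 (Real.summable_one_div_nat_pow.2 (by norm_num : 1 < 2))
    refine h.congr fun i => ?_
    push_cast
    rfl
  have hmem : e ∈ closure (M : Set (FockSpace φ p)) := by
    refine mem_closure_of_coeff_le_tail hC hbound htfin g hgM fun n i => ?_
    have h1 : taylor (g n - e) = PowerSeries.X ^ L *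
        ((PowerSeries.trunc (n + 1) b⁻¹ : PowerSeries ℂ) * b - 1) := by
      rw [map_sub, hgt, he, hb, Polynomial.coe_mul, Polynomial.coe_pow, Polynomial.coe_X, hL,
        pow_add]
      ring
    rw [h1, PowerSeries.coeff_X_pow_mul']
    by_cases hi : L ≤ i
    · rw [if_pos hi]
      obtain ⟨m, rfl⟩ : ∃ m, i = m + L := ⟨i - L, by omega⟩
      rw [Nat.add_sub_cancel]
      have h2 := htrunc n m
      by_cases hm : m ≤ n
      · rw [if_pos hm] at h2
        rw [norm_le_zero_iff.1 h2, enorm_zero, zero_mul]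
        exact zero_le
      · rw [if_neg hm] at h2
        rw [if_neg (by omega), ← ofReal_norm, ← ENNReal.ofReal_mul (norm_nonneg _)]
        refine ENNReal.ofReal_le_ofReal ?_
        have hw := coeffWeight_pos hα (m + L)
        calc _ ≤ C' * polyWeight β D (A + N) m *
              ((((m + L : ℕ) : ℝ) + 1) ^ Q / facWeight β D (m + L)) := by
              refine mul_le_mul_of_nonneg_right h2 ?_
              positivity
          _ = C' * (polyWeight β D (A + N) m *
              ((((m + L : ℕ) : ℝ) + 1) ^ Q / facWeight β D (m + L))) := by ring
          _ ≤ C' * (((L : ℝ) + 1) ^ (A + N + Q + 2) / (((m + L : ℕ) : ℝ) + 1) ^ 2) := by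
              gcongr
              exact polyWeight_mul_div_facWeight_le hβ hD hLβ m
          _ = _ := by ring
    · rw [if_neg hi, enorm_zero, zero_mul]
      exact zero_le
  rwa [hMc.closure_eq] at hmem

theorem vanishingAtZero_subset_of_X_pow_mem (hα : 1 < α) (hp0 : p ≠ 0) (hp : p ≠ ∞)
    (hφ : ∀ r : ℝ, 0 ≤ r → φ r = r ^ α) {M : Submodule ℂ (FockSpace φ p)}
    (hMc : IsClosed (M : Set (FockSpace φ p))) (hM : IsVolterraInvariant M) {L : ℕ}
    {e : FockSpace φ p} (he : e ∈ M) (hel : taylor e = PowerSeries.X ^ L) :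
    vanishingAtZero φ p L ⊆ M := by
  rw [vanishingAtZero_eq_closure_span hα hp0 hp hφ]
  refine closure_minimal (SetLike.coe_subset_coe.2 (Submodule.span_le.2 ?_)) hMc
  rintro f ⟨k, hk, hfk⟩
  obtain ⟨g, hg, hgt⟩ := exists_mem_taylor_eq_X_pow_mul hM he (k - L)
  have h : f = (k.factorial : ℂ) • g := by
    refine taylor_injective ?_
    rw [taylor_of_toFun_eq_pow hfk, map_smul, hgt, hel, ← pow_add, Nat.sub_add_cancel hk]
  rw [h]
  exact M.smul_mem _ hg

/-- A closed invariant subspace containing a function of order `N` at `0` contains all functions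
vanishing to order `N`. It does so for some large `L` in place of `N`; to come down from `L + 1` to
`L` one subtracts a multiple of `V ^ (L - N) f`, which has order exactly `L`. -/
theorem vanishingAtZero_subset_of_mem (hα : 1 < α) (hp0 : p ≠ 0) (hp : p ≠ ∞)
    (hφ : ∀ r : ℝ, 0 ≤ r → φ r = r ^ α) {M : Submodule ℂ (FockSpace φ p)}
    (hMc : IsClosed (M : Set (FockSpace φ p))) (hM : IsVolterraInvariant M)
    {f : FockSpace φ p} (hf : f ∈ M) {N : ℕ} (hfN : f ∈ vanishingAtZero φ p N)
    (hfN0 : PowerSeries.coeff N (taylor f) ≠ 0) : vanishingAtZero φ p N ⊆ M := by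
  obtain ⟨b, hb⟩ := mem_vanishingAtZero.1 hfN
  have hb0 : PowerSeries.constantCoeff b ≠ 0 := by
    intro h
    apply hfN0
    rw [hb, PowerSeries.coeff_X_pow_mul', if_pos le_rfl, Nat.sub_self]
    simpa using h
  obtain ⟨L, hNL, e, he, hel⟩ := exists_X_pow_mem hα hp0 hp hφ hMc hM hf hb hb0
  have hLM := vanishingAtZero_subset_of_X_pow_mem hα hp0 hp hφ hMc hM he hel
  refine Nat.decreasingInduction' (P := fun L => vanishingAtZero φ p L ⊆ M) ?_ hNL hLM
  intro k _ hNk ih h hh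
  obtain ⟨g, hg, hgt⟩ := exists_mem_taylor_eq_X_pow_mul hM hf (k - N)
  have hgk : taylor g = PowerSeries.X ^ k * b := by
    rw [hgt, hb, ← mul_assoc, ← pow_add, Nat.sub_add_cancel hNk]
  obtain ⟨d, hd⟩ := mem_vanishingAtZero.1 hh
  set c : ℂ := PowerSeries.constantCoeff d * (PowerSeries.constantCoeff b)⁻¹ with hc
  have h1 : h - c • g ∈ M := by
    refine ih (mem_vanishingAtZero.2 ?_)
    rw [map_sub, map_smul, hgk, hd, PowerSeries.smul_eq_C_mul, mul_left_comm, ← mul_sub, pow_succ]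
    refine mul_dvd_mul_left _ (PowerSeries.X_dvd_iff.2 ?_)
    rw [map_sub, map_mul, PowerSeries.constantCoeff_C, hc, mul_assoc, inv_mul_cancel₀ hb0, mul_one,
      sub_self]
  have h2 := M.add_mem h1 (M.smul_mem c hg)
  rwa [sub_add_cancel] at h2

/-- A nonzero closed invariant subspace consists of all functions vanishing to the smallest order
that occurs in it. -/
theorem exists_eq_vanishingAtZero (hα : 1 < α) (hp0 : p ≠ 0) (hp : p ≠ ∞)
    (hφ : ∀ r : ℝ, 0 ≤ r → φ r = r ^ α) {M : Submodule ℂ (FockSpace φ p)}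
    (hMc : IsClosed (M : Set (FockSpace φ p))) (hM : IsVolterraInvariant M) (hM0 : M ≠ ⊥) :
    ∃ N, (M : Set (FockSpace φ p)) = vanishingAtZero φ p N := by
  classical
  have hex : ∃ N, ∃ f ∈ M, PowerSeries.coeff N (taylor f) ≠ 0 := by
    obtain ⟨f, hf, hf0⟩ := M.ne_bot_iff.1 hM0
    by_contra! h
    refine hf0 (taylor_injective ?_)
    rw [map_zero]
    ext N
    rw [h N f hf, map_zero]
  have hmin : ∀ f ∈ M, f ∈ vanishingAtZero φ p (Nat.find hex) := by
    intro f hf k hk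
    have := Nat.find_min hex hk
    push Not at this
    rw [← coeff_taylor]
    exact this f hf
  obtain ⟨f, hf, hfN⟩ := Nat.find_spec hex
  exact ⟨Nat.find hex, subset_antisymm hmin
    (vanishingAtZero_subset_of_mem hα hp0 hp hφ hMc hM hf (hmin f hf) hfN)⟩

end FockSpace

theorem mainTheorem8 (α : ℝ) (hα : 2 < α) (p : ℝ≥0∞) (hp0 : p ≠ 0) (hp : p ≠ ∞)
    (φ : ℝ → ℝ) (hφ : ∀ r : ℝ, 0 ≤ r → φ r = r ^ α) :
    (∀ f : FockSpace φ p, ∃ g : FockSpace φ p, g.toFun = volterra f.toFun) ∧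
    (∀ N : ℕ, vanishingAtZero φ p N =
      closure (Submodule.span ℂ (monomialsFrom φ p N) : Set (FockSpace φ p))) ∧
    (∀ M : Submodule ℂ (FockSpace φ p),
      (IsClosed (M : Set (FockSpace φ p)) ∧ IsVolterraInvariant M ∧ M ≠ ⊥ ∧ M ≠ ⊤) ↔
        ∃ N : ℕ, 1 ≤ N ∧ (M : Set (FockSpace φ p)) = vanishingAtZero φ p N) := by
  have hα1 : 1 < α := by linarith
  refine ⟨FockSpace.exists_toFun_eq_volterra hα1 hp0 hp hφ,
    FockSpace.vanishingAtZero_eq_closure_span hα1 hp0 hp hφ, fun M => ⟨?_, ?_⟩⟩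
  · rintro ⟨hMc, hM, hbot, htop⟩
    obtain ⟨N, hN⟩ := FockSpace.exists_eq_vanishingAtZero hα1 hp0 hp hφ hMc hM hbot
    refine ⟨N, Nat.one_le_iff_ne_zero.2 ?_, hN⟩
    rintro rfl
    refine htop (Submodule.eq_top_iff'.2 fun f => ?_)
    rw [← SetLike.mem_coe, hN, FockSpace.mem_vanishingAtZero, pow_zero]
    exact one_dvd _
  · rintro ⟨N, hN, hMN⟩
    have hmem : ∀ f, f ∈ M ↔ PowerSeries.X ^ N ∣ FockSpace.taylor f := fun f => by
      rw [← SetLike.mem_coe, hMN, FockSpace.mem_vanishingAtZero]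
    choose e he _ using FockSpace.exists_taylor_eq_X_pow (φ := φ) hα1 hp0 hp hφ
    refine ⟨?_, fun f hf => ?_, fun h => ?_, fun h => ?_⟩
    · rw [hMN]; exact FockSpace.isClosed_vanishingAtZero hα1 hp0 hp hφ N
    · obtain ⟨g, hg⟩ := FockSpace.exists_toFun_eq_volterra hα1 hp0 hp hφ f
      refine ⟨g, (hmem g).2 ?_, hg⟩
      rw [FockSpace.taylor_of_toFun_eq_volterra hg]
      exact ((hmem f).1 hf).mul_left _
    · have h1 : e N ∈ M := (hmem _).2 (by rw [he])
      rw [h, Submodule.mem_bot] at h1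
      have h2 := congrArg (PowerSeries.coeff N) (he N)
      rw [h1, map_zero, map_zero, PowerSeries.coeff_X_pow_self] at h2
      exact zero_ne_one h2
    · have h1 : e 0 ∈ M := h ▸ Submodule.mem_top
      rw [hmem, he, pow_zero] at h1
      have h2 := PowerSeries.X_pow_dvd_iff.1 h1 0 (by omega)
      simp at h2
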